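/- Let $G$ be a locally compact, Hausdorff, second countable étale groupoid with range and source maps $r,s$, and let $\mathbf T\times G^{(0)}\to\Sigma\to G$, $\sigma\mapsto\dot\sigma$, be a twist over $G$, i.e. a central extension of topological groupoids by the trivial circle bundle. Let $C_c(G,\Sigma)$ be the $*$-algebra of continuous compactly supported sections of the associated line bundle $L$, viewed as functions $f:\Sigma\to\mathbf C$ with $f(z\sigma)=f(\sigma)\overline z$. Let $A=C^*_r(G,\Sigma)$ be its completion for the norm $\|f\|=\sup_{x\in G^{(0)}}\|\pi_x(f)\|$, where $\pi_x$ is the regular representation $\pi_x(f)\xi(\sigma)=\sum_{\dot\tau\in G_x}f(\sigma\tau^{-1})\xi(\tau)$ on the Hilbert space of square-summable sections of $L$ over $G_x=s^{-1}(x)$. The elements $a$ of $A$ are viewed as sections of $L$, and $\mathrm{supp}'(a)=\{\gamma\in G: a(\gamma)\neq 0\}$ is the open support of $a$. Let $B=C_0(G^{(0)})$, where $h\in C_0(G^{(0)})$ is the section $(x,z)\mapsto h(x)\overline z$ on $G^{(0)}\times\mathbf T$, extended by $0$. Let $N(B)=\{n\in A: nBn^*\subset B \text{ and } n^*Bn\subset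 B\}$ be the normalizer of $B$ in $A$. A set $S\subset G$ is a bisection if $r|_S$ and $s|_S$ are injective; then $\alpha_S:s(S)\to r(S)$ is the map with $\alpha_S(s(\gamma))=r(\gamma)$ for $\gamma\in S$. 1. If the open support $S=\mathrm{supp}'(a)$ of $a\in A$ is a bisection, then $a\in N(B)$. Moreover $a^*a$, $aa^*$ and $a^*ba$ (for $b\in B$) lie in $B$, $s(S)=\{x: a^*a(x)>0\}$, $r(S)=\{x: aa^*(x)>0\}$, and $\alpha_S$ is the unique homeomorphism $\alpha_a$ between these open subsets of $G^{(0)}$ such that $(a^*ba)(x)=b(\alpha_a(x))\,(a^*a)(x)$ for all $b\in B$ and all $x$ with $a^*a(x)>0$. 2. If $G$ is essentially principal, i.e. if the interior of $\{\gamma\in G: r(\gamma)=s(\gamma)\}$ is $G^{(0)}$, then $N(B)$ consists exactly of the elements of $A$ whose open support is a bisection. 3. (Without assuming that $G$ is essentially principal.) $B$ is a regular sub-$C^*$-algebra of $A$: it is a sub-$C^*$-algebra of $A$, and $N(B)$ generates $A$ as a $C^*$-algebra. -/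

import Mathlib

open scoped ComplexConjugate ComplexOrder ZeroAtInfty InnerProductSpace

noncomputable section

/-! ## Topological groupoids -/

/-- A topological groupoid, presented by its space of arrows `G`.  Units are particular arrows, so
that the range and source maps take values in `G`.  The product is only meaningful on composable
pairs, i.e. pairs `(γ, δ)` with `s γ = r δ`: all laws, and continuity, are only required there, and
the value of `γ * δ` for other pairs is irrelevant. -/
class TopologicalGroupoid (G : Type*) [TopologicalSpace G] extends Mul G, Inv G where
  /-- the range of an arrow -/
  r : G → G
  /-- the source of an arrow -/
  s : G → G
  r_r : ∀ γ, r (r γ) = r γ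
  s_r : ∀ γ, s (r γ) = r γ
  r_s : ∀ γ, r (s γ) = s γ
  s_s : ∀ γ, s (s γ) = s γ
  r_mul : ∀ γ δ, s γ = r δ → r (γ * δ) = r γ
  s_mul : ∀ γ δ, s γ = r δ → s (γ * δ) = s δ
  mul_assoc_eq : ∀ γ δ ε, s γ = r δ → s δ = r ε → (γ * δ) * ε = γ * (δ * ε)
  r_mul_self : ∀ γ, r γ * γ = γ
  mul_s_self : ∀ γ, γ * s γ = γ
  r_inv : ∀ γ, r γ⁻¹ = s γ
  s_inv : ∀ γ, s γ⁻¹ = r γ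
  mul_inv_eq : ∀ γ, γ * γ⁻¹ = r γ
  inv_mul_eq : ∀ γ, γ⁻¹ * γ = s γ
  continuous_r : Continuous r
  continuous_s : Continuous s
  continuous_inv' : Continuous fun γ : G => γ⁻¹
  continuousOn_mul : ContinuousOn (fun p : G × G => p.1 * p.2) {p | s p.1 = r p.2}

namespace TopologicalGroupoid

section

variable (G : Type*) [TopologicalSpace G] [TopologicalGroupoid G]

/-- The unit space `G⁽⁰⁾`, with the topology induced by `G`. -/
def unitSpace : Set G := {γ | s γ = γ}

/-- The isotropy bundle `G' = {γ | r γ = s γ}`. -/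
def isotropy : Set G := {γ | r γ = s γ}

/-- `G` is essentially principal if the interior of the isotropy bundle is the unit space. -/
def EssentiallyPrincipal : Prop := interior (isotropy G) = unitSpace G

variable {G}

/-- The range map as a map onto the unit space. -/
def rangeMap (γ : G) : unitSpace G := ⟨r γ, s_r γ⟩

/-- The source map as a map onto the unit space. -/
def sourceMap (γ : G) : unitSpace G := ⟨s γ, s_s γ⟩

variable (G) in
/-- `G` is étale if its source map is a local homeomorphism onto the unit space (equivalently, by
inversion, its range map is one). -/
def IsEtale : Prop := IsLocalHomeomorph (sourceMap : G → unitSpace G)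

/-- A bisection: both `r` and `s` are injective on `S`. -/
def IsBisection (S : Set G) : Prop := Set.InjOn (r : G → G) S ∧ Set.InjOn (s : G → G) S

/-- `φ` is the partial homeomorphism `α_S : s(S) → r(S)`, `α_S(x) = r(Sx)`, of the unit space
defined by the bisection `S`. -/
def IsBisectionHomeo (S : Set G)
    (φ : OpenPartialHomeomorph (unitSpace G) (unitSpace G)) : Prop :=
  φ.source = sourceMap '' S ∧ φ.target = rangeMap '' S ∧
    ∀ γ ∈ S, φ (sourceMap γ) = rangeMap γ

theorem r_unit (x : unitSpace G) : r (x : G) = x := by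
  have h : s (x : G) = x := x.2
  rw [← h, r_s]

theorem eq_inv_of_mul (γ δ : G) (h : s γ = r δ) (hm : γ * δ = r γ) : δ = γ⁻¹ := by
  have h1 : γ⁻¹ * (γ * δ) = δ := by
    rw [← mul_assoc_eq _ _ _ (s_inv γ) h, inv_mul_eq, h, r_mul_self]
  rw [← h1, hm, ← s_inv, mul_s_self]

end

end TopologicalGroupoid

/-! ## Twists -/

open TopologicalGroupoid in
/-- A twist `T × G⁽⁰⁾ → E → G` over the topological groupoid `G`: a central extension of
topological groupoids by the trivial circle bundle. -/
structure Twist (G E : Type*) [TopologicalSpace G] [TopologicalGroupoid G]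
    [TopologicalSpace E] [TopologicalGroupoid E] where
  /-- the inclusion `T × G⁽⁰⁾ → E` -/
  incl : Circle × unitSpace G → E
  /-- the projection `E → G`, `σ ↦ σ̇` -/
  proj : E → G
  incl_isEmbedding : Topology.IsEmbedding incl
  r_incl : ∀ z x, r (incl (z, x)) = incl (1, x)
  s_incl : ∀ z x, s (incl (z, x)) = incl (1, x)
  incl_mul : ∀ z w x, incl (z, x) * incl (w, x) = incl (z * w, x)
  continuous_proj : Continuous proj
  isOpenMap_proj : IsOpenMap proj
  surjective_proj : Function.Surjective proj
  proj_r : ∀ σ, proj (r σ) = r (proj σ)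
  proj_s : ∀ σ, proj (s σ) = s (proj σ)
  proj_mul : ∀ σ τ, s σ = r τ → proj (σ * τ) = proj σ * proj τ
  proj_incl : ∀ z x, proj (incl (z, x)) = x
  /-- exactness -/
  exact : ∀ σ, proj σ ∈ unitSpace G → σ ∈ Set.range incl
  /-- centrality -/
  central : ∀ z σ, incl (z, rangeMap (proj σ)) * σ = σ * incl (z, sourceMap (proj σ))

namespace Twist

section

open TopologicalGroupoid

variable {G E : Type*} [TopologicalSpace G] [TopologicalGroupoid G]
  [TopologicalSpace E] [TopologicalGroupoid E] (T : Twist G E)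

/-- The action `(z, σ) ↦ zσ` of the circle on `E`. -/
def act (z : Circle) (σ : E) : E := T.incl (z, rangeMap (T.proj σ)) * σ

theorem r_eq (σ : E) : r σ = T.incl (1, rangeMap (T.proj σ)) := by
  obtain ⟨⟨z, x⟩, h⟩ := T.exact (r σ) (by rw [T.proj_r]; exact s_r _)
  have h1 : r σ = T.incl (1, x) := by rw [← T.r_incl z x, h, r_r]
  have h2 : x = rangeMap (T.proj σ) := by
    apply Subtype.ext
    rw [← T.proj_incl 1 x, ← h1, T.proj_r]; rfl
  rw [h1, h2]

theorem s_eq (σ : E) : s σ = T.incl (1, sourceMap (T.proj σ)) := by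
  have h := T.r_eq (s σ)
  rw [r_s] at h
  rw [h]
  congr 2
  apply Subtype.ext
  change r (T.proj (s σ)) = s (T.proj σ)
  rw [T.proj_s, r_s]

theorem s_incl_rangeMap (z : Circle) (σ : E) : s (T.incl (z, rangeMap (T.proj σ))) = r σ := by
  rw [T.s_incl, T.r_eq]

theorem proj_act (z : Circle) (σ : E) : T.proj (T.act z σ) = T.proj σ := by
  rw [act, T.proj_mul _ _ (T.s_incl_rangeMap z σ), T.proj_incl]
  exact r_mul_self _

theorem act_act (z w : Circle) (σ : E) : T.act z (T.act w σ) = T.act (z * w) σ := by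
  have h := T.proj_act w σ
  unfold act at h ⊢
  rw [h, ← mul_assoc_eq _ _ _ (by rw [T.s_incl, T.r_incl]) (T.s_incl_rangeMap w σ), T.incl_mul]

theorem act_injective {z w : Circle} {σ : E} (h : T.act z σ = T.act w σ) : z = w := by
  have key : ∀ u, T.act u σ * σ⁻¹ = T.incl (u, rangeMap (T.proj σ)) := fun u => by
    rw [act, mul_assoc_eq _ _ _ (T.s_incl_rangeMap u σ) (r_inv σ).symm, mul_inv_eq, T.r_eq,
      T.incl_mul, mul_one]
  have h2 := T.incl_isEmbedding.injective ((key z).symm.trans ((congrArg (· * σ⁻¹) h).trans (key w)))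
  exact congrArg Prod.fst h2

theorem exists_act {σ τ : E} (h : T.proj σ = T.proj τ) : ∃ z, T.act z σ = τ := by
  have hs : s τ = s σ := by rw [T.s_eq, T.s_eq, h]
  have hc : s τ = r σ⁻¹ := by rw [hs, r_inv]
  have hinv : T.proj σ⁻¹ = (T.proj σ)⁻¹ := by
    apply eq_inv_of_mul
    · rw [← T.proj_s, ← T.proj_r, r_inv]
    · rw [← T.proj_mul _ _ (r_inv σ).symm, mul_inv_eq, T.proj_r]
  have hp : T.proj (τ * σ⁻¹) = r (T.proj σ) := by
    rw [T.proj_mul _ _ hc, hinv, ← h, mul_inv_eq]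
  obtain ⟨⟨z, x⟩, hz⟩ := T.exact (τ * σ⁻¹) (by rw [hp]; exact s_r _)
  have hx : x = rangeMap (T.proj σ) := by
    apply Subtype.ext
    rw [← T.proj_incl z x, hz, hp]; rfl
  refine ⟨z, ?_⟩
  rw [act, ← hx, hz, mul_assoc_eq _ _ _ hc (s_inv σ), inv_mul_eq, ← hs, mul_s_self]

/-- For `σ` and `τ` over the same element of `G`, the `z` in the circle with `τ = zσ`. -/
def phase {σ τ : E} (h : T.proj σ = T.proj τ) : Circle := (T.exists_act h).choose

theorem act_phase {σ τ : E} (h : T.proj σ = T.proj τ) : T.act (T.phase h) σ = τ :=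
  (T.exists_act h).choose_spec

/-- A chosen element of `E` over `γ`. -/
def lift (γ : G) : E := Function.surjInv T.surjective_proj γ

theorem proj_lift (γ : G) : T.proj (T.lift γ) = γ := Function.surjInv_eq _ γ

/-! ## The line bundle and the Hilbert space of the regular representations -/

/-- The fiber `L_γ` of the associated line bundle: functions `f` on the fiber of `E` over `γ` such
that `f(zσ) = f(σ) z̄`. -/
def lineSubmodule (γ : G) : Submodule ℂ ({σ : E // T.proj σ = γ} → ℂ) where
  carrier := {f | ∀ (z : Circle) (σ : {σ : E // T.proj σ = γ}),
    f ⟨T.act z σ, (T.proj_act z σ).trans σ.2⟩ = f σ * conj (z : ℂ)}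
  add_mem' hf hg z σ := by
    simp only [Pi.add_apply]
    rw [hf z σ, hg z σ, add_mul]
  zero_mem' z σ := by simp
  smul_mem' c f hf z σ := by
    simp only [Pi.smul_apply, smul_eq_mul]
    rw [hf z σ, mul_assoc]

/-- The fiber `L_γ` as a type of its own, to be given its hermitian inner product. -/
def Line (γ : G) : Type _ := T.lineSubmodule γ

instance (γ : G) : AddCommGroup (T.Line γ) := inferInstanceAs (AddCommGroup (T.lineSubmodule γ))

instance (γ : G) : Module ℂ (T.Line γ) := inferInstanceAs (Module ℂ (T.lineSubmodule γ))

/-- Evaluation of an element of `L_γ` at a point of `E` over `γ`. -/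
def Line.eval {γ : G} (σ : E) (h : T.proj σ = γ) : T.Line γ →ₗ[ℂ] ℂ where
  toFun f := f.1 ⟨σ, h⟩
  map_add' _ _ := rfl
  map_smul' _ _ := rfl

theorem Line.eval_act {γ : G} (z : Circle) (σ : E) (h : T.proj σ = γ)
    (h' : T.proj (T.act z σ) = γ) (f : T.Line γ) :
    Line.eval T (T.act z σ) h' f = Line.eval T σ h f * conj (z : ℂ) :=
  f.2 z ⟨σ, h⟩

theorem Line.eval_injective {γ : G} (σ : E) (h : T.proj σ = γ) :
    Function.Injective (Line.eval T σ h) := by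
  intro f g hfg
  apply Subtype.ext
  funext τ
  obtain ⟨τ, hτ⟩ := τ
  obtain ⟨z, rfl⟩ := T.exists_act (h.trans hτ.symm)
  have h1 := Line.eval_act T z σ h hτ f
  have h2 := Line.eval_act T z σ h hτ g
  rw [hfg, ← h2] at h1
  exact h1

/-- The norm of `L_γ` is the absolute value at a point over `γ`; see `Line.norm_eq`. -/
instance (γ : G) : NormedAddCommGroup (T.Line γ) :=
  NormedAddCommGroup.induced _ ℂ (Line.eval T (T.lift γ) (T.proj_lift γ))
    (Line.eval_injective T _ _)

/-- The inner product of `L_γ` is evaluated at a point over `γ`; see `Line.inner_eq`. -/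
instance (γ : G) : InnerProductSpace ℂ (T.Line γ) where
  toNormedSpace := NormedSpace.induced ℂ (T.Line γ) ℂ (Line.eval T (T.lift γ) (T.proj_lift γ))
  inner f g := ⟪Line.eval T (T.lift γ) (T.proj_lift γ) f,
    Line.eval T (T.lift γ) (T.proj_lift γ) g⟫_ℂ
  norm_sq_eq_re_inner f := norm_sq_eq_re_inner (𝕜 := ℂ) (Line.eval T (T.lift γ) (T.proj_lift γ) f)
  conj_inner_symm f g := inner_conj_symm _ _
  add_left f g h := by rw [map_add, inner_add_left]
  smul_left f g c := by rw [map_smul, inner_smul_left]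

instance (γ : G) : FiniteDimensional ℂ (T.Line γ) :=
  FiniteDimensional.of_injective (Line.eval T (T.lift γ) (T.proj_lift γ)) (Line.eval_injective T _ _)

instance (γ : G) : CompleteSpace (T.Line γ) := FiniteDimensional.complete ℂ _

/-- The inner product of `L_γ` may be computed at any point over `γ`. -/
theorem Line.inner_eq {γ : G} (σ : E) (h : T.proj σ = γ) (f g : T.Line γ) :
    ⟪f, g⟫_ℂ = conj (Line.eval T σ h f) * Line.eval T σ h g := by
  obtain ⟨z, rfl⟩ := T.exists_act ((T.proj_lift γ).trans h.symm)
  rw [Line.eval_act T z _ (T.proj_lift γ), Line.eval_act T z _ (T.proj_lift γ)]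
  have hz : (z : ℂ) * conj (z : ℂ) = 1 := by
    rw [Complex.mul_conj, Circle.normSq_coe, Complex.ofReal_one]
  change ⟪Line.eval T (T.lift γ) (T.proj_lift γ) f,
    Line.eval T (T.lift γ) (T.proj_lift γ) g⟫_ℂ = _
  rw [RCLike.inner_apply, map_mul, Complex.conj_conj]
  linear_combination (-(conj (Line.eval T (T.lift γ) (T.proj_lift γ) f)) *
    Line.eval T (T.lift γ) (T.proj_lift γ) g) * hz

theorem Line.norm_eq {γ : G} (σ : E) (h : T.proj σ = γ) (f : T.Line γ) :
    ‖f‖ = ‖Line.eval T σ h f‖ := by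
  obtain ⟨z, rfl⟩ := T.exists_act ((T.proj_lift γ).trans h.symm)
  rw [Line.eval_act T z _ (T.proj_lift γ), norm_mul, RCLike.norm_conj, Circle.norm_coe, mul_one]
  rfl

/-- The Hilbert space of square-summable (not necessarily continuous) sections of the line bundle
over `G`.  It is the Hilbert direct sum, over the units `x`, of the spaces
`H_x = ℓ²(G_x, L_x)` of square-summable sections over the fibers `G_x = s⁻¹(x)`. -/
abbrev RegularSpace : Type _ := lp (fun γ : G => T.Line γ) 2

/-- The value at `σ` of a square-summable section, viewed as a function on `E`. -/
def value (ξ : T.RegularSpace) (σ : E) : ℂ := Line.eval T σ rfl (ξ (T.proj σ))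

theorem value_act (ξ : T.RegularSpace) (z : Circle) (σ : E) :
    T.value ξ (T.act z σ) = T.value ξ σ * conj (z : ℂ) := by
  have key : ∀ γ (h : T.proj (T.act z σ) = γ) (h' : T.proj σ = γ),
      T.value ξ (T.act z σ) = Line.eval T σ h' (ξ γ) * conj (z : ℂ) := by
    intro γ h h'
    subst h
    exact Line.eval_act T z σ h' rfl _
  exact key _ (T.proj_act z σ) rfl

/-- The element of `L_σ̇` with value `1` at `σ`. -/
def unitVec (σ : E) : T.Line (T.proj σ) :=
  ⟨fun τ => conj (T.phase τ.2.symm : ℂ), by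
    rintro z ⟨τ, hτ⟩
    have hz : T.phase (((T.proj_act z τ).trans hτ).symm) = z * T.phase hτ.symm := by
      apply T.act_injective (σ := σ)
      rw [T.act_phase, ← T.act_act, T.act_phase]
    change conj ((T.phase (((T.proj_act z τ).trans hτ).symm) : Circle) : ℂ) =
      conj ((T.phase hτ.symm : Circle) : ℂ) * conj (z : ℂ)
    rw [hz, Circle.coe_mul, map_mul, mul_comm]⟩

/-- The unit vector `ε_σ`: `ε_σ(zσ) = z̄`, and `ε_σ(τ) = 0` if `τ̇ ≠ σ̇`. -/
def pointMass (σ : E) : T.RegularSpace := by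
  classical exact lp.single 2 (T.proj σ) (T.unitVec σ)

theorem value_pointMass_self (z : Circle) (σ : E) :
    T.value (T.pointMass σ) (T.act z σ) = conj (z : ℂ) := by
  classical
  have h1 : T.value (T.pointMass σ) σ = 1 := by
    change Line.eval T σ rfl (lp.single 2 (T.proj σ) (T.unitVec σ) (T.proj σ)) = 1
    rw [lp.single_apply_self]
    change conj ((T.phase (rfl : T.proj σ = T.proj σ) : Circle) : ℂ) = 1
    have h2 : T.phase (rfl : T.proj σ = T.proj σ) = 1 := by
      apply T.act_injective (σ := σ)
      rw [T.act_phase, act, ← T.r_eq, r_mul_self]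
    rw [h2, Circle.coe_one, map_one]
  rw [value_act, h1, one_mul]

theorem value_pointMass_of_ne {σ τ : E} (h : T.proj τ ≠ T.proj σ) :
    T.value (T.pointMass σ) τ = 0 := by
  classical
  change Line.eval T τ rfl (lp.single 2 (T.proj σ) (T.unitVec σ) (T.proj τ)) = 0
  rw [lp.single_apply_ne _ _ _ h, map_zero]

/-! ## The reduced C⋆-algebra -/

/-- `f ∈ C_c(G, E)`: a continuous section with compact support of the line bundle, viewed as a
function on `E` with `f(zσ) = f(σ) z̄`. -/
def IsCompactSection (f : E → ℂ) : Prop :=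
  Continuous f ∧ (∀ (z : Circle) (σ : E), f (T.act z σ) = f σ * conj (z : ℂ)) ∧
    ∃ K : Set G, IsCompact K ∧ ∀ σ, f σ ≠ 0 → T.proj σ ∈ K

/-- The bounded operator `a` is `π(f) = ⨁ₓ π_x(f)`, given by
`π(f)ξ(σ) = ∑ f(στ⁻¹) ξ(τ)`, the sum being over `τ̇ ∈ G_{s(σ)}`.  The summand only depends on `τ̇`,
and for `f ∈ C_c(G, E)` with `G` étale only finitely many summands are nonzero. -/
def IsRegularRep (f : E → ℂ) (a : T.RegularSpace →L[ℂ] T.RegularSpace) : Prop :=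
  ∀ (ξ : T.RegularSpace) (σ : E), T.value (a ξ) σ =
    ∑' γ : {γ : G // s γ = s (T.proj σ)}, f (σ * (T.lift γ)⁻¹) * T.value ξ (T.lift γ)

/-- `A = C⋆_r(G, E)`, the completion of `C_c(G, E)` for the norm `‖f‖ = sup_x ‖π_x(f)‖`.
Since `‖⨁ₓ π_x(f)‖ = sup_x ‖π_x(f)‖`, this is the norm closure of the `⋆`-algebra of all operators
`π(f) = ⨁ₓ π_x(f)`, `f ∈ C_c(G, E)`. -/
def reducedAlgebra : Set (T.RegularSpace →L[ℂ] T.RegularSpace) :=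
  closure {a | ∃ f, T.IsCompactSection f ∧ T.IsRegularRep f a}

/-- The section (as a function on `E`) defined by an element of `C⋆_r(G, E)`:
`a(σ) = (a ε_{s(σ)})(σ) = ⟨ε_σ, a ε_{s(σ)}⟩`. It is `f` if `a = π(f)`. -/
def sectionOf (a : T.RegularSpace →L[ℂ] T.RegularSpace) (σ : E) : ℂ :=
  T.value (a (T.pointMass (s σ))) σ

/-- The open support `supp'(a) = {γ | a(γ) ≠ 0}`. -/
def openSupport (a : T.RegularSpace →L[ℂ] T.RegularSpace) : Set G :=
  {γ | ∃ σ, T.proj σ = γ ∧ T.sectionOf a σ ≠ 0}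

theorem ext_value {ξ η : T.RegularSpace} (h : ∀ σ, T.value ξ σ = T.value η σ) : ξ = η := by
  apply lp.ext
  funext γ
  obtain ⟨σ, rfl⟩ := T.surjective_proj γ
  exact Line.eval_injective T σ rfl (h σ)

theorem norm_mul_apply_le (h : C₀(unitSpace G, ℂ)) (ξ : T.RegularSpace) (γ : G) :
    ‖h (rangeMap γ) • ξ γ‖ ≤ ‖((‖h‖ : ℂ) • ξ) γ‖ := by
  have h1 : ‖h (rangeMap γ)‖ ≤ ‖h‖ := by
    rw [← ZeroAtInftyContinuousMap.norm_toBCF_eq_norm]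
    exact h.toBCF.norm_coe_le_norm (rangeMap γ)
  rw [lp.coeFn_smul, Pi.smul_apply, norm_smul, norm_smul]
  simpa using mul_le_mul_of_nonneg_right h1 (norm_nonneg (ξ γ))

/-- Multiplication by `h ∘ r`, for `h ∈ C₀(G⁽⁰⁾)`, as a linear map. -/
def mulLin (h : C₀(unitSpace G, ℂ)) : T.RegularSpace →ₗ[ℂ] T.RegularSpace where
  toFun ξ := ⟨fun γ => h (rangeMap γ) • ξ γ,
    Memℓp.mono (g := fun γ => ‖((‖h‖ : ℂ) • ξ) γ‖) (lp.memℓp ((‖h‖ : ℂ) • ξ)).norm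
      (T.norm_mul_apply_le h ξ)⟩
  map_add' ξ η := by
    apply lp.ext
    funext γ
    exact smul_add (h (rangeMap γ)) (ξ γ) (η γ)
  map_smul' c ξ := by
    apply lp.ext
    funext γ
    exact smul_comm (h (rangeMap γ)) c (ξ γ)

/-- The operator of multiplication by `h ∘ r`, for `h ∈ C₀(G⁽⁰⁾)`. -/
def mulOp (h : C₀(unitSpace G, ℂ)) : T.RegularSpace →L[ℂ] T.RegularSpace :=
  (T.mulLin h).mkContinuous ‖h‖ (fun ξ => by
    have h1 : ‖T.mulLin h ξ‖ ≤ ‖(‖h‖ : ℂ) • ξ‖ :=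
      lp.norm_mono (by norm_num) (T.norm_mul_apply_le h ξ)
    refine h1.trans_eq ?_
    rw [norm_smul]; simp)

theorem mulOp_apply (h : C₀(unitSpace G, ℂ)) (ξ : T.RegularSpace) (γ : G) :
    T.mulOp h ξ γ = h (rangeMap γ) • ξ γ := rfl

/-- The embedding of `C₀(G⁽⁰⁾)` into the bounded operators: `(hξ)(σ) = h(r(σ)) ξ(σ)`. -/
def diag : C₀(unitSpace G, ℂ) →⋆ₙₐ[ℂ] (T.RegularSpace →L[ℂ] T.RegularSpace) where
  toFun := T.mulOp
  map_smul' c h := by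
    ext ξ : 1
    apply lp.ext; funext γ
    exact mul_smul c _ _
  map_zero' := by
    ext ξ : 1
    apply lp.ext; funext γ
    exact zero_smul ℂ _
  map_add' h k := by
    ext ξ : 1
    apply lp.ext; funext γ
    exact add_smul _ _ _
  map_mul' h k := by
    ext ξ : 1
    apply lp.ext; funext γ
    exact mul_smul _ _ _
  map_star' h := by
    rw [ContinuousLinearMap.star_eq_adjoint, ContinuousLinearMap.eq_adjoint_iff]
    intro ξ η
    rw [lp.inner_eq_tsum, lp.inner_eq_tsum]
    refine tsum_congr fun γ => ?_
    rw [mulOp_apply, mulOp_apply, inner_smul_left, inner_smul_right,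
      ZeroAtInftyContinuousMap.star_apply, RCLike.star_def, Complex.conj_conj]

/-- The section defined by `h ∈ C₀(G⁽⁰⁾)` takes the value `h(x) z̄` at `(z, x) ∈ T × G⁽⁰⁾`. -/
theorem sectionOf_diag_incl (h : C₀(unitSpace G, ℂ)) (z : Circle) (x : unitSpace G) :
    T.sectionOf (T.diag h) (T.incl (z, x)) = h x * conj (z : ℂ) := by
  have hx : rangeMap (x : G) = x := Subtype.ext (r_unit x)
  have hact : T.act z (T.incl (1, x)) = T.incl (z, x) := by
    rw [act, T.proj_incl, hx, T.incl_mul, mul_one]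
  have h1 := T.value_pointMass_self z (T.incl (1, x))
  rw [hact] at h1
  have h2 : T.sectionOf (T.diag h) (T.incl (z, x)) =
      h (rangeMap (T.proj (T.incl (z, x)))) * T.value (T.pointMass (s (T.incl (z, x))))
        (T.incl (z, x)) := rfl
  rw [h2, T.s_incl, h1, T.proj_incl, hx]

/-- The section defined by `h ∈ C₀(G⁽⁰⁾)` vanishes off `T × G⁽⁰⁾`. -/
theorem sectionOf_diag_of_notMem (h : C₀(unitSpace G, ℂ)) (σ : E) (hσ : T.proj σ ∉ unitSpace G) :
    T.sectionOf (T.diag h) σ = 0 := by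
  have h2 : T.sectionOf (T.diag h) σ =
      h (rangeMap (T.proj σ)) * T.value (T.pointMass (s σ)) σ := rfl
  rw [h2, T.value_pointMass_of_ne, mul_zero]
  intro hc
  apply hσ
  rw [hc, T.proj_s]
  exact s_s _

/-- `B = C₀(G⁽⁰⁾)`, as a `⋆`-subalgebra of the bounded operators. -/
def diagonal : NonUnitalStarSubalgebra ℂ (T.RegularSpace →L[ℂ] T.RegularSpace) :=
  NonUnitalStarAlgHom.range T.diag

end

end Twist

/-! ## Normalizers -/

section

variable {𝓐 : Type*} [NonUnitalCStarAlgebra 𝓐]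

/-- The normalizer `N(B) = {n ∈ A | n B n⋆ ⊆ B and n⋆ B n ⊆ B}` of `B` in `A`, where `A` and `B` are
sub-C⋆-algebras of an ambient C⋆-algebra. -/
def normalizerIn (A B : Set 𝓐) : Set 𝓐 :=
  {n | n ∈ A ∧ (∀ b ∈ B, n * b * star n ∈ B) ∧ (∀ b ∈ B, star n * b * n ∈ B)}

/-- `B` is a regular sub-C⋆-algebra of `A`: it is a closed `⋆`-subalgebra of the ambient
C⋆-algebra contained in `A`, and `A` is the closed `⋆`-subalgebra generated by the normalizer. -/
def IsRegularIn (A : Set 𝓐) (B : NonUnitalStarSubalgebra ℂ 𝓐) : Prop :=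
  (B : Set 𝓐) ⊆ A ∧ IsClosed (B : Set 𝓐) ∧
    ((NonUnitalStarAlgebra.adjoin ℂ (normalizerIn A (B : Set 𝓐))).topologicalClosure : Set 𝓐) = A

/-- For an embedding `ι` of `C₀(X)` into a C⋆-algebra and an element `n`, the assertion that `n⋆n`,
`nn⋆` and all `n⋆bn` with `b ∈ C₀(X)` lie in `C₀(X)`, and that `φ` is a homeomorphism from
`dom(n) = {x | n⋆n(x) > 0}` onto `ran(n) = {x | nn⋆(x) > 0}` such that
`n⋆bn(x) = b(φ(x)) n⋆n(x)` for all `b ∈ C₀(X)` and `x ∈ dom(n)`. -/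
def IsNormalizerHomeo {X : Type*} [TopologicalSpace X] (ι : C₀(X, ℂ) →⋆ₙₐ[ℂ] 𝓐) (n : 𝓐)
    (φ : OpenPartialHomeomorph X X) : Prop :=
  ∃ p q : C₀(X, ℂ), ι p = star n * n ∧ ι q = n * star n ∧
    φ.source = {x | 0 < p x} ∧ φ.target = {x | 0 < q x} ∧
    ∀ b : C₀(X, ℂ), ∃ c : C₀(X, ℂ), ι c = star n * ι b * n ∧
      ∀ x ∈ φ.source, c x = b (φ x) * p x

end

end

/-! An operator is encoded by its matrix `coeff a σ τ = ⟨ε_σ, a ε_τ⟩`. For `a` in the reduced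
algebra the entries depend only on `στ⁻¹` and vanish when `s σ ≠ s τ` (`isConv_of_mem`), since these
are closed conditions that hold on `C_c`. Hence `a` is determined by its section, and it lies in `B`
as soon as its matrix is diagonal (`exists_diag_eq`).

If the open support `S` of `a` is a bisection, every row and column has at most one nonzero entry
over `G`. Then `a⋆ba` is diagonal, with value `b(r γ)|a(γ)|²` at `s γ` for `γ ∈ S`
(`exists_diag_eq_star_mul`). This gives the normalizer property and the formula for `α_S`;
uniqueness holds because `C₀` separates points.

Conversely, let `a` normalize `B`, and suppose that two arrows of `S` have the same source `x` but
different ranges. Choose `b₁, b₂ ≥ 0` in `B` with `b₁b₂ = 0`, each equal to `1` at one of the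
ranges. Both `a⋆bᵢa` are nonzero at `x`, yet `(a⋆b₁a)w(a⋆b₂a) = a⋆b₁(awa⋆)b₂a = 0`, because `awa⋆`
lies in the commutative algebra `B`. So the set of products `SS⁻¹` lies in the isotropy. It is open
because multiplication is open, so essential principality puts it in the unit space, and `s` is
injective on `S`. The same argument for `a⋆` handles `r`.

For regularity, a partition of unity splits each compactly supported section into sections carried
by open bisections; these act as bounded operators and are normalizers by the first part. The same
splitting shows that the image of `C_c` is closed under products. -/

namespace TopologicalGroupoid

/-! ### Groupoid identities, and the topology of étale groupoids -/

section

variable {G : Type*} [TopologicalSpace G] [TopologicalGroupoid G]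

theorem inv_inv_eq (γ : G) : γ⁻¹⁻¹ = γ :=
  (eq_inv_of_mul γ⁻¹ γ (s_inv γ) (by rw [inv_mul_eq, r_inv])).symm

theorem inv_mul_cancel_left_eq {γ δ : G} (h : s γ = r δ) : γ⁻¹ * (γ * δ) = δ := by
  rw [← mul_assoc_eq _ _ _ (s_inv γ) h, inv_mul_eq, h, r_mul_self]

theorem mul_inv_cancel_left_eq {γ δ : G} (h : r γ = r δ) : γ * (γ⁻¹ * δ) = δ := by
  rw [← mul_assoc_eq _ _ _ (r_inv γ).symm ((s_inv γ).trans h), mul_inv_eq, h, r_mul_self]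

theorem inv_mul_cancel_right_eq {γ δ : G} (h : s γ = s δ) : γ * δ⁻¹ * δ = γ := by
  rw [mul_assoc_eq _ _ _ (h.trans (r_inv δ).symm) (s_inv δ), inv_mul_eq, ← h, mul_s_self]

theorem mul_inv_rev_eq {γ δ : G} (h : s γ = r δ) : (γ * δ)⁻¹ = δ⁻¹ * γ⁻¹ := by
  have h1 : s δ⁻¹ = r γ⁻¹ := by rw [s_inv, r_inv, h]
  refine (eq_inv_of_mul _ _ ?_ ?_).symm
  · rw [s_mul _ _ h, r_mul _ _ h1, r_inv]
  · rw [mul_assoc_eq _ _ _ h (by rw [r_mul _ _ h1, r_inv]), mul_inv_cancel_left_eq, mul_inv_eq,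
      r_mul _ _ h]
    rw [r_inv, h]

theorem inv_s (γ : G) : (s γ)⁻¹ = s γ := by
  refine (eq_inv_of_mul _ _ ?_ ?_).symm
  · rw [s_s, r_s]
  · have h := mul_s_self (s γ)
    rw [s_s] at h
    rw [h, r_s]

theorem mul_inv_s (γ : G) : γ * (s γ)⁻¹ = γ := by rw [inv_s, mul_s_self]

/-- Two arrows with the same source and with `γδ⁻¹` a unit are equal. -/
theorem eq_of_mul_inv_mem_unitSpace {γ δ : G} (h : s γ = s δ) (hu : γ * δ⁻¹ ∈ unitSpace G) :
    γ = δ := by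
  have h1 : s γ = r δ⁻¹ := by rw [h, r_inv]
  have h2 : γ * δ⁻¹ = r δ := by
    rw [← hu, s_mul _ _ h1, s_inv]
  rw [← inv_mul_cancel_right_eq h, h2, r_mul_self]

/-- Inversion as a homeomorphism. -/
def invHomeomorph : G ≃ₜ G where
  toFun γ := γ⁻¹
  invFun γ := γ⁻¹
  left_inv := inv_inv_eq
  right_inv := inv_inv_eq
  continuous_toFun := continuous_inv'
  continuous_invFun := continuous_inv'

theorem continuous_rangeMap : Continuous (rangeMap : G → unitSpace G) :=
  continuous_r.subtype_mk _

theorem IsEtale.isLocalHomeomorph_rangeMap (hG : IsEtale G) :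
    IsLocalHomeomorph (rangeMap : G → unitSpace G) := by
  have h := hG.comp (invHomeomorph (G := G)).isLocalHomeomorph
  have h2 : (rangeMap : G → unitSpace G) = sourceMap ∘ invHomeomorph := by
    funext γ
    exact Subtype.ext (s_inv γ).symm
  rwa [h2]

/-- Every arrow of an étale groupoid lies in an open bisection. -/
theorem IsEtale.exists_isBisection (hG : IsEtale G) (γ : G) :
    ∃ U : Set G, IsOpen U ∧ γ ∈ U ∧ IsBisection U := by
  obtain ⟨e, he, h1⟩ := hG γ
  obtain ⟨e', he', h2⟩ := hG.isLocalHomeomorph_rangeMap γ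
  refine ⟨e.source ∩ e'.source, e.open_source.inter e'.open_source, ⟨he, he'⟩, ?_, ?_⟩
  · intro x hx y hy hxy
    apply e'.injOn hx.2 hy.2
    rw [← h2]
    exact Subtype.ext hxy
  · intro x hx y hy hxy
    apply e.injOn hx.1 hy.1
    rw [← h1]
    exact Subtype.ext hxy

theorem IsBisection.mono {S U : Set G} (hU : IsBisection U) (h : S ⊆ U) : IsBisection S :=
  ⟨hU.1.mono h, hU.2.mono h⟩

/-- The unit space of an étale groupoid is open. -/
theorem IsEtale.isOpen_unitSpace (hG : IsEtale G) : IsOpen (unitSpace G) := by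
  rw [isOpen_iff_mem_nhds]
  intro x hx
  obtain ⟨U, hU, hxU, -, hs⟩ := hG.exists_isBisection x
  have h1 : (s : G → G) ⁻¹' U ∈ nhds x :=
    continuous_s.continuousAt.preimage_mem_nhds (by rw [show s x = x from hx]; exact hU.mem_nhds hxU)
  -- `γ` and `s γ` have the same source, so they coincide once both lie in `U`.
  filter_upwards [h1, hU.mem_nhds hxU] with γ h2 h3
  exact hs h2 h3 (s_s γ)

theorem isClosed_unitSpace [T2Space G] : IsClosed (unitSpace G) :=
  isClosed_eq continuous_s continuous_id

/-- In an étale groupoid, multiplication is an open map. -/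
theorem IsEtale.mul_mem_nhds (hG : IsEtale G) {U V : Set G} (hU : IsOpen U) (hV : IsOpen V)
    {γ δ : G} (hγ : γ ∈ U) (hδ : δ ∈ V) (h : s γ = r δ) :
    {ε | ∃ γ' ∈ U, ∃ δ' ∈ V, s γ' = r δ' ∧ ε = γ' * δ'} ∈ nhds (γ * δ) := by
  -- With `g = e.symm ∘ rangeMap`, a local section of the range map through `γ`, every `ε` near `γδ`
  -- factors as `g(ε) · (g(ε)⁻¹ε)`, and both factors vary continuously.
  obtain ⟨e, he, h1⟩ := hG.isLocalHomeomorph_rangeMap γ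
  have hr : (rangeMap (γ * δ) : unitSpace G) = e γ := by
    rw [← h1]
    exact Subtype.ext (r_mul _ _ h)
  have hrt : ContinuousAt (rangeMap : G → unitSpace G) (γ * δ) := continuous_rangeMap.continuousAt
  have ht : ∀ᶠ ε in nhds (γ * δ), (rangeMap ε : unitSpace G) ∈ e.target :=
    hrt.eventually_mem (by rw [hr]; exact e.open_target.mem_nhds (e.map_source he))
  have hg : ContinuousAt (fun ε : G => e.symm (rangeMap ε)) (γ * δ) := by
    refine ContinuousAt.comp (g := e.symm) ?_ hrt
    rw [hr]
    exact e.symm.continuousAt (by simpa using e.map_source he)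
  have hg0 : e.symm (rangeMap (γ * δ)) = γ := by rw [hr, e.left_inv he]
  have hrg : ∀ᶠ ε in nhds (γ * δ), r (e.symm (rangeMap ε)) = r ε := by
    filter_upwards [ht] with ε hε
    have := e.right_inv hε
    rw [← h1] at this
    exact congrArg Subtype.val this
  -- Multiplication is continuous only on composable pairs, so convergence must take place within
  -- that set.
  have hpair : Filter.Tendsto (fun ε : G => ((e.symm (rangeMap ε))⁻¹, ε)) (nhds (γ * δ))
      (nhdsWithin (γ⁻¹, γ * δ) {p : G × G | s p.1 = r p.2}) := by
    refine tendsto_nhdsWithin_iff.2 ⟨?_, ?_⟩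
    · have h2 : ContinuousAt (fun ε : G => (e.symm (rangeMap ε))⁻¹) (γ * δ) :=
        ContinuousAt.comp (g := fun γ : G => γ⁻¹) continuous_inv'.continuousAt hg
      have h3 := h2.prodMk (continuousAt_id (x := γ * δ))
      simpa [ContinuousAt, hg0] using h3
    · filter_upwards [hrg] with ε hε
      simpa [s_inv] using hε
  have hmul := (continuousOn_mul (G := G) (γ⁻¹, γ * δ)
    (by simp [s_inv, r_mul _ _ h])).tendsto.comp hpair
  have hmul' : Filter.Tendsto (fun ε : G => (e.symm (rangeMap ε))⁻¹ * ε) (nhds (γ * δ))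
      (nhds δ) := by
    simpa [Function.comp_def, inv_mul_cancel_left_eq h] using hmul
  have hgt : Filter.Tendsto (fun ε : G => e.symm (rangeMap ε)) (nhds (γ * δ)) (nhds γ) := by
    simpa [ContinuousAt, hg0] using hg
  filter_upwards [hrg, hmul' (hV.mem_nhds hδ), hgt (hU.mem_nhds hγ)] with ε h2 h3 h4
  refine ⟨_, h4, _, h3, ?_, (mul_inv_cancel_left_eq h2).symm⟩
  rw [r_mul _ _ (by rw [s_inv, h2]), r_inv]

/-- The partial homeomorphism of the unit space defined by an open bisection. -/
theorem IsEtale.exists_isBisectionHomeo (hG : IsEtale G) {S : Set G} (hS : IsOpen S)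
    (hb : IsBisection S) :
    ∃ φ : OpenPartialHomeomorph (unitSpace G) (unitSpace G), IsBisectionHomeo S φ := by
  -- The inverse of an injection on `S` needs a default value outside the image, so empty `G` is set
  -- apart.
  rcases isEmpty_or_nonempty G with hE | hE
  · refine ⟨OpenPartialHomeomorph.refl _, ?_, ?_, fun γ => isEmptyElim γ⟩
    · exact Set.eq_of_subset_of_subset (fun x => isEmptyElim x.1) (fun x => isEmptyElim x.1)
    · exact Set.eq_of_subset_of_subset (fun x => isEmptyElim x.1) (fun x => isEmptyElim x.1)
  have key : ∀ f : G → unitSpace G, IsLocalHomeomorph f → Set.InjOn f S →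
      ∃ e : OpenPartialHomeomorph G (unitSpace G), e.source = S ∧ ⇑e = f := fun f hf hi =>
    ⟨OpenPartialHomeomorph.ofContinuousOpen (hi.bijOn_image.toPartialEquiv f S (f '' S))
      hf.continuous.continuousOn hf.isOpenMap hS, rfl, rfl⟩
  obtain ⟨e, he, h1⟩ := key _ hG fun x hx y hy h => hb.2 hx hy (congrArg Subtype.val h)
  obtain ⟨e', he', h2⟩ := key _ hG.isLocalHomeomorph_rangeMap
    fun x hx y hy h => hb.1 hx hy (congrArg Subtype.val h)
  have hsrc : e.source = e'.source := he.trans he'.symm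
  refine ⟨e.symm.trans' e' hsrc, ?_, ?_, ?_⟩
  · change e.target = _
    rw [← e.image_source_eq_target, he, h1]
  · change e'.target = _
    rw [← e'.image_source_eq_target, he', h2]
  · intro γ hγ
    change e' (e.symm (sourceMap γ)) = _
    rw [← h1, e.left_inv (by rwa [he]), h2]

end

end TopologicalGroupoid

/-! ### Circle action, matrix coefficients and convolution operators -/

namespace Twist

section

open TopologicalGroupoid

variable {G E : Type*} [TopologicalSpace G] [TopologicalGroupoid G]
  [TopologicalSpace E] [TopologicalGroupoid E] (T : Twist G E)

theorem rangeMap_eq_iff {γ δ : G} : (rangeMap γ : unitSpace G) = rangeMap δ ↔ r γ = r δ :=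
  Subtype.ext_iff

/-- Units of `E` are the `incl (1, x)`, so they correspond to units of `G`; composability in `E` can
therefore be tested in `G`. -/
theorem r_eq_r_iff (σ τ : E) : r σ = r τ ↔ r (T.proj σ) = r (T.proj τ) := by
  constructor
  · intro h
    rw [← T.proj_r, ← T.proj_r, h]
  · intro h
    rw [T.r_eq, T.r_eq]
    congr 2
    exact Subtype.ext h

theorem s_eq_r_iff (σ τ : E) : s σ = r τ ↔ s (T.proj σ) = r (T.proj τ) := by
  have h := T.r_eq_r_iff (s σ) τ
  rwa [r_s, T.proj_s, r_s] at h

theorem s_eq_s_iff (σ τ : E) : s σ = s τ ↔ s (T.proj σ) = s (T.proj τ) := by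
  have h := T.s_eq_r_iff σ (s τ)
  rwa [r_s, T.proj_s, r_s] at h

theorem proj_inv (σ : E) : T.proj σ⁻¹ = (T.proj σ)⁻¹ := by
  apply eq_inv_of_mul
  · rw [← T.proj_s, ← T.proj_r, r_inv]
  · rw [← T.proj_mul _ _ (r_inv σ).symm, mul_inv_eq, T.proj_r]

theorem act_one (σ : E) : T.act 1 σ = σ := by
  rw [act, ← T.r_eq, r_mul_self]

theorem r_act (z : Circle) (σ : E) : r (T.act z σ) = r σ := by
  rw [T.r_eq_r_iff, T.proj_act]

theorem s_act (z : Circle) (σ : E) : s (T.act z σ) = s σ := by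
  rw [T.s_eq_s_iff, T.proj_act]

theorem act_mul (z : Circle) {σ τ : E} (h : s σ = r τ) : T.act z σ * τ = T.act z (σ * τ) := by
  have h1 : (rangeMap (T.proj (σ * τ)) : unitSpace G) = rangeMap (T.proj σ) := by
    rw [rangeMap_eq_iff, ← T.r_eq_r_iff, r_mul _ _ h]
  rw [act, act, h1, mul_assoc_eq _ _ _ (T.s_incl_rangeMap z σ) h]

/-- This is where centrality of the extension enters. -/
theorem mul_act (z : Circle) {σ τ : E} (h : s σ = r τ) : σ * T.act z τ = T.act z (σ * τ) := by
  have h1 : (rangeMap (T.proj τ) : unitSpace G) = sourceMap (T.proj σ) :=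
    Subtype.ext ((T.s_eq_r_iff _ _).1 h).symm
  rw [← T.act_mul z h, act, act, h1, T.central, mul_assoc_eq]
  · rw [T.r_incl, T.s_eq]
  · rw [← h1, T.s_incl_rangeMap]

theorem inv_act (z : Circle) (σ : E) : (T.act z σ)⁻¹ = T.act z⁻¹ σ⁻¹ := by
  have h1 : s σ = r σ⁻¹ := (r_inv σ).symm
  have h2 : s σ = r (T.act z⁻¹ σ⁻¹) := by rw [T.r_act, h1]
  refine (eq_inv_of_mul _ _ ?_ ?_).symm
  · rw [T.s_act, h2]
  · rw [T.act_mul z h2, T.mul_act _ h1, T.act_act, mul_inv_cancel, T.act_one, mul_inv_eq, T.r_act]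

theorem circle_mul_conj (z : Circle) : (z : ℂ) * conj (z : ℂ) = 1 := by
  rw [Complex.mul_conj, Circle.normSq_coe, Complex.ofReal_one]

theorem coe_inv_circle (z : Circle) : ((z⁻¹ : Circle) : ℂ) = conj (z : ℂ) :=
  Circle.coe_inv_eq_conj z

/-! ### Values and inner products -/

theorem value_eq_eval (ξ : T.RegularSpace) {γ : G} (σ : E) (h : T.proj σ = γ) :
    T.value ξ σ = Line.eval T σ h (ξ γ) := by
  subst h; rfl

theorem value_add (ξ η : T.RegularSpace) (σ : E) :
    T.value (ξ + η) σ = T.value ξ σ + T.value η σ := rfl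

theorem value_sub (ξ η : T.RegularSpace) (σ : E) :
    T.value (ξ - η) σ = T.value ξ σ - T.value η σ :=
  map_sub (Line.eval T σ rfl) (ξ (T.proj σ)) (η (T.proj σ))

theorem value_smul (c : ℂ) (ξ : T.RegularSpace) (σ : E) :
    T.value (c • ξ) σ = c * T.value ξ σ := rfl

theorem value_pointMass (σ : E) : T.value (T.pointMass σ) σ = 1 := by
  have h := T.value_pointMass_self 1 σ
  rwa [T.act_one, Circle.coe_one, map_one] at h

theorem inner_eq_tsum_value (ξ η : T.RegularSpace) :
    ⟪ξ, η⟫_ℂ = ∑' γ, conj (T.value ξ (T.lift γ)) * T.value η (T.lift γ) := by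
  rw [lp.inner_eq_tsum]
  refine tsum_congr fun γ => ?_
  rw [Line.inner_eq T (T.lift γ) (T.proj_lift γ), T.value_eq_eval _ _ (T.proj_lift γ),
    T.value_eq_eval _ _ (T.proj_lift γ)]

/-- Pairing with a unit vector makes evaluation contractive and gives access to adjoints. -/
theorem value_eq_inner (ξ : T.RegularSpace) (σ : E) : T.value ξ σ = ⟪T.pointMass σ, ξ⟫_ℂ := by
  classical
  have h1 : ⟪T.pointMass σ, ξ⟫_ℂ = ⟪T.unitVec σ, ξ (T.proj σ)⟫_ℂ := by
    unfold pointMass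
    convert lp.inner_single_left (𝕜 := ℂ) (T.proj σ) (T.unitVec σ) ξ
  have h2 : T.value (T.pointMass σ) σ = Line.eval T σ rfl (T.unitVec σ) := by
    change Line.eval T σ rfl (lp.single 2 (T.proj σ) (T.unitVec σ) (T.proj σ)) = _
    rw [lp.single_apply_self]
  rw [T.value_pointMass] at h2
  rw [h1, Line.inner_eq T σ rfl, ← h2, map_one, one_mul]
  rfl

theorem norm_pointMass (σ : E) : ‖T.pointMass σ‖ = 1 := by
  have h : ⟪T.pointMass σ, T.pointMass σ⟫_ℂ = 1 := by
    rw [← T.value_eq_inner, T.value_pointMass]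
  rw [inner_self_eq_norm_sq_to_K] at h
  have h2 : ‖T.pointMass σ‖ ^ 2 = 1 := Complex.ofReal_injective (by simpa using h)
  nlinarith [norm_nonneg (T.pointMass σ)]

theorem norm_value_le (ξ : T.RegularSpace) (σ : E) : ‖T.value ξ σ‖ ≤ ‖ξ‖ := by
  rw [T.value_eq_inner]
  simpa [T.norm_pointMass] using norm_inner_le_norm (𝕜 := ℂ) (T.pointMass σ) ξ

/-! ### Matrix coefficients -/

/-- The matrix coefficient `⟨ε_σ, a ε_τ⟩` of an operator. -/
noncomputable def coeff (a : T.RegularSpace →L[ℂ] T.RegularSpace) (σ τ : E) : ℂ :=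
  T.value (a (T.pointMass τ)) σ

variable (a b : T.RegularSpace →L[ℂ] T.RegularSpace)

theorem sectionOf_eq_coeff (σ : E) : T.sectionOf a σ = T.coeff a σ (s σ) := rfl

theorem coeff_add (σ τ : E) : T.coeff (a + b) σ τ = T.coeff a σ τ + T.coeff b σ τ := rfl

theorem coeff_sub (σ τ : E) : T.coeff (a - b) σ τ = T.coeff a σ τ - T.coeff b σ τ :=
  T.value_sub _ _ _

theorem coeff_smul (c : ℂ) (σ τ : E) : T.coeff (c • a) σ τ = c * T.coeff a σ τ := rfl

theorem coeff_zero (σ τ : E) : T.coeff 0 σ τ = 0 := by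
  have h := T.coeff_smul 0 0 σ τ
  rwa [zero_smul, zero_mul] at h

theorem coeff_sum {ι : Type*} (t : Finset ι)
    (f : ι → T.RegularSpace →L[ℂ] T.RegularSpace) (σ τ : E) :
    T.coeff (∑ i ∈ t, f i) σ τ = ∑ i ∈ t, T.coeff (f i) σ τ := by
  classical
  induction t using Finset.induction_on with
  | empty => simp [coeff_zero]
  | insert i t hi ih => rw [Finset.sum_insert hi, Finset.sum_insert hi, coeff_add, ih]

theorem norm_coeff_le (σ τ : E) : ‖T.coeff a σ τ‖ ≤ ‖a‖ :=
  (T.norm_value_le _ _).trans (by simpa [T.norm_pointMass] using a.le_opNorm (T.pointMass τ))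

theorem continuous_coeff (σ τ : E) : Continuous fun a => T.coeff a σ τ := by
  have h : (fun a => T.coeff a σ τ) = fun a => ⟪T.pointMass σ, a (T.pointMass τ)⟫_ℂ := by
    funext a; exact T.value_eq_inner _ _
  rw [h]
  fun_prop

theorem coeff_star (σ τ : E) : T.coeff (star a) σ τ = conj (T.coeff a τ σ) := by
  rw [coeff, coeff, T.value_eq_inner, T.value_eq_inner, ContinuousLinearMap.star_eq_adjoint,
    ContinuousLinearMap.adjoint_inner_right, inner_conj_symm]

theorem coeff_act_left (z : Circle) (σ τ : E) :
    T.coeff a (T.act z σ) τ = T.coeff a σ τ * conj (z : ℂ) := T.value_act _ _ _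

theorem coeff_act_right (z : Circle) (σ τ : E) :
    T.coeff a σ (T.act z τ) = T.coeff a σ τ * z := by
  rw [← star_star a, T.coeff_star, T.coeff_act_left, T.coeff_star (star a), map_mul,
    Complex.conj_conj]

theorem value_apply_eq_inner (ξ : T.RegularSpace) (σ : E) :
    T.value (a ξ) σ = ⟪star a (T.pointMass σ), ξ⟫_ℂ := by
  rw [T.value_eq_inner, ContinuousLinearMap.star_eq_adjoint,
    ContinuousLinearMap.adjoint_inner_left]

/-- The row of index `σ` is the conjugate of the ℓ² vector `star a (pointMass σ)`, so the sum is an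
inner product and no density argument is needed. -/
theorem value_apply_eq_tsum (ξ : T.RegularSpace) (σ : E) :
    T.value (a ξ) σ = ∑' γ, T.coeff a σ (T.lift γ) * T.value ξ (T.lift γ) := by
  rw [T.value_apply_eq_inner, T.inner_eq_tsum_value]
  refine tsum_congr fun γ => ?_
  have h : T.value (star a (T.pointMass σ)) (T.lift γ) = conj (T.coeff a σ (T.lift γ)) :=
    T.coeff_star a _ _
  rw [h, Complex.conj_conj]

theorem coeff_mul (σ τ : E) :
    T.coeff (a * b) σ τ = ∑' γ, T.coeff a σ (T.lift γ) * T.coeff b (T.lift γ) τ :=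
  T.value_apply_eq_tsum a (b (T.pointMass τ)) σ

variable {a b} in
/-- Operators are determined by their matrix coefficients. -/
theorem ext_coeff (h : ∀ σ τ, T.coeff a σ τ = T.coeff b σ τ) : a = b := by
  ext ξ : 1
  apply T.ext_value
  intro σ
  rw [T.value_apply_eq_tsum, T.value_apply_eq_tsum]
  simp_rw [h]

/-- The term of index `ρ̇` of the matrix product does not depend on the point `ρ` over `ρ̇`. -/
theorem coeff_mul_coeff_eq {ρ ρ' : E} (h : T.proj ρ = T.proj ρ') (σ τ : E) :
    T.coeff a σ ρ * T.coeff b ρ τ = T.coeff a σ ρ' * T.coeff b ρ' τ := by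
  obtain ⟨z, rfl⟩ := T.exists_act h
  rw [T.coeff_act_left, T.coeff_act_right]
  linear_combination (-(T.coeff a σ ρ * T.coeff b ρ τ)) * circle_mul_conj z

/-- A matrix product with only one nonzero term. -/
theorem coeff_mul_of_single (σ τ ρ : E)
    (h : ∀ ρ', T.proj ρ' ≠ T.proj ρ → T.coeff a σ ρ' * T.coeff b ρ' τ = 0) :
    T.coeff (a * b) σ τ = T.coeff a σ ρ * T.coeff b ρ τ := by
  rw [T.coeff_mul, tsum_eq_single (T.proj ρ)]
  · exact T.coeff_mul_coeff_eq a b (T.proj_lift _) σ τ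
  · intro γ hγ
    exact h _ (by rwa [T.proj_lift])

/-- A matrix product all of whose terms vanish. -/
theorem coeff_mul_eq_zero (σ τ : E) (h : ∀ ρ, T.coeff a σ ρ * T.coeff b ρ τ = 0) :
    T.coeff (a * b) σ τ = 0 := by
  rw [T.coeff_mul]
  simp [h]

/-! ### Convolution operators -/

/-- The operator `a` commutes with the right translations: its matrix coefficients are those of
the convolution by the section `f`. -/
def IsConv (f : E → ℂ) (a : T.RegularSpace →L[ℂ] T.RegularSpace) : Prop :=
  (∀ σ τ, s σ = s τ → T.coeff a σ τ = f (σ * τ⁻¹)) ∧ ∀ σ τ, s σ ≠ s τ → T.coeff a σ τ = 0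

/-- The sections of the line bundle, viewed as functions on `E`. -/
def IsEquivariant (f : E → ℂ) : Prop :=
  ∀ (z : Circle) (σ : E), f (T.act z σ) = f σ * conj (z : ℂ)

variable {a b} {f g : E → ℂ}

theorem IsEquivariant.eq_zero_of_proj_eq (hf : T.IsEquivariant f) {σ τ : E}
    (h : T.proj σ = T.proj τ) (h0 : f σ = 0) : f τ = 0 := by
  obtain ⟨z, rfl⟩ := T.exists_act h
  rw [hf, h0, zero_mul]

theorem IsConv.sectionOf_eq (h : T.IsConv f a) : T.sectionOf a = f := by
  funext σ
  rw [T.sectionOf_eq_coeff, h.1 _ _ (s_s σ).symm, mul_inv_s]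

theorem isEquivariant_sectionOf (a : T.RegularSpace →L[ℂ] T.RegularSpace) :
    T.IsEquivariant (T.sectionOf a) := by
  intro z σ
  rw [T.sectionOf_eq_coeff, T.s_act, T.coeff_act_left, T.sectionOf_eq_coeff]

theorem IsConv.isEquivariant (h : T.IsConv f a) : T.IsEquivariant f := by
  rw [← h.sectionOf_eq]; exact T.isEquivariant_sectionOf a

/-- Inversion turns `z` into `z⁻¹`, hence `z̄` into `z`. This cancels the phase of a vector at `τ`,
so the convolution summand depends only on the point of `G`. -/
theorem IsEquivariant.mul_inv_act (hf : T.IsEquivariant f) (z : Circle) {σ τ : E}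
    (h : s σ = s τ) : f (σ * (T.act z τ)⁻¹) = f (σ * τ⁻¹) * z := by
  rw [T.inv_act, T.mul_act _ (h.trans (r_inv τ).symm), hf, coe_inv_circle, Complex.conj_conj]

/-- One direction tests the formula on point masses, the other expands along the matrix. It allows
the reduced algebra to be studied through matrix coefficients. -/
theorem isRegularRep_iff_isConv (hf : T.IsEquivariant f) : T.IsRegularRep f a ↔ T.IsConv f a := by
  constructor
  · intro h
    have h0 : ∀ (σ τ : E) (γ : G), γ ≠ T.proj τ →
        f (σ * (T.lift γ)⁻¹) * T.value (T.pointMass τ) (T.lift γ) = 0 := by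
      intro σ τ γ hγ
      rw [T.value_pointMass_of_ne (by rwa [T.proj_lift]), mul_zero]
    constructor
    · intro σ τ hst
      rw [coeff, h, tsum_eq_single ⟨T.proj τ, ((T.s_eq_s_iff _ _).1 hst).symm⟩]
      · obtain ⟨z, hz⟩ := T.exists_act (T.proj_lift (T.proj τ)).symm
        rw [← hz, hf.mul_inv_act T z hst, T.value_pointMass_self, mul_assoc, circle_mul_conj,
          mul_one]
      · intro γ hγ
        exact h0 _ _ _ fun hc => hγ (Subtype.ext hc)
    · intro σ τ hst
      rw [coeff, h]
      refine (tsum_congr fun γ => h0 _ _ _ ?_).trans tsum_zero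
      intro hc
      apply hst
      rw [T.s_eq_s_iff, ← hc, γ.2]
  · intro h ξ σ
    rw [T.value_apply_eq_tsum]
    have h1 : ∀ γ, T.coeff a σ (T.lift γ) * T.value ξ (T.lift γ) =
        Set.indicator {γ : G | s γ = s (T.proj σ)}
          (fun γ => f (σ * (T.lift γ)⁻¹) * T.value ξ (T.lift γ)) γ := by
      intro γ
      by_cases hγ : s γ = s (T.proj σ)
      · rw [Set.indicator_of_mem (by exact hγ), h.1]
        rw [T.s_eq_s_iff, T.proj_lift, hγ]
      · rw [Set.indicator_of_notMem (by exact hγ), h.2, zero_mul]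
        rw [Ne, T.s_eq_s_iff, T.proj_lift]
        exact fun hc => hγ hc.symm
    simp_rw [h1]
    exact (tsum_subtype _ _).symm

theorem IsConv.add (ha : T.IsConv f a) (hb : T.IsConv g b) : T.IsConv (f + g) (a + b) :=
  ⟨fun σ τ h => by rw [coeff_add, ha.1 _ _ h, hb.1 _ _ h]; rfl,
    fun σ τ h => by rw [coeff_add, ha.2 _ _ h, hb.2 _ _ h, add_zero]⟩

theorem IsConv.smul (c : ℂ) (ha : T.IsConv f a) : T.IsConv (c • f) (c • a) :=
  ⟨fun σ τ h => by rw [coeff_smul, ha.1 _ _ h]; rfl,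
    fun σ τ h => by rw [coeff_smul, ha.2 _ _ h, mul_zero]⟩

theorem isConv_zero : T.IsConv 0 0 :=
  ⟨fun σ τ _ => by rw [coeff_zero]; rfl, fun σ τ _ => by rw [coeff_zero]⟩

theorem IsConv.star (ha : T.IsConv f a) : T.IsConv (fun σ => conj (f σ⁻¹)) (star a) := by
  constructor
  · intro σ τ h
    dsimp only
    rw [coeff_star, ha.1 _ _ h.symm, mul_inv_rev_eq (h.trans (r_inv τ).symm), inv_inv_eq]
  · intro σ τ h
    rw [coeff_star, ha.2 _ _ (Ne.symm h), map_zero]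

end

end Twist

/-! ### Bounded operators from sections supported on a bisection -/

namespace Twist

section

open TopologicalGroupoid

variable {G E : Type*} [TopologicalSpace G] [TopologicalGroupoid G]
  [TopologicalSpace E] [TopologicalGroupoid E] (T : Twist G E)

theorem exists_eval_eq_one {γ : G} (σ : E) (h : T.proj σ = γ) :
    ∃ v : T.Line γ, Line.eval T σ h v = 1 := by
  subst h
  refine ⟨T.unitVec σ, ?_⟩
  classical
  have h2 : T.value (T.pointMass σ) σ = Line.eval T σ rfl (T.unitVec σ) := by
    change Line.eval T σ rfl (lp.single 2 (T.proj σ) (T.unitVec σ) (T.proj σ)) = _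
    rw [lp.single_apply_self]
  rw [← h2, T.value_pointMass]

theorem norm_apply_eq (ξ : T.RegularSpace) (γ : G) : ‖ξ γ‖ = ‖T.value ξ (T.lift γ)‖ := by
  rw [T.value_eq_eval ξ _ (T.proj_lift γ), Line.norm_eq T (T.lift γ) (T.proj_lift γ)]

/-- Weighted composition operators: if `c` is bounded and `e` is injective on the support of `c`,
then `ξ ↦ c · (ξ ∘ e)` is bounded. -/
theorem exists_weightedComp (c : G → ℂ) (e : G → G) {C : ℝ} (hc : ∀ γ, ‖c γ‖ ≤ C)
    (he : Set.InjOn e {γ | c γ ≠ 0}) :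
    ∃ a : T.RegularSpace →L[ℂ] T.RegularSpace,
      ∀ ξ γ, T.value (a ξ) (T.lift γ) = c γ * T.value ξ (T.lift (e γ)) := by
  classical
  rcases isEmpty_or_nonempty G with hE | ⟨⟨γ₀⟩⟩
  · exact ⟨0, fun ξ γ => hE.elim γ⟩
  have hC : 0 ≤ C := (norm_nonneg _).trans (hc γ₀)
  choose v hv using fun γ : G => T.exists_eval_eq_one (T.lift γ) (T.proj_lift γ)
  have hvn : ∀ γ, ‖v γ‖ = 1 := fun γ => by
    rw [Line.norm_eq T (T.lift γ) (T.proj_lift γ), hv, norm_one]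
  let F : T.RegularSpace → ∀ γ, T.Line γ := fun ξ γ => (c γ * T.value ξ (T.lift (e γ))) • v γ
  have hF : ∀ ξ γ, ‖F ξ γ‖ = ‖c γ‖ * ‖ξ (e γ)‖ := fun ξ γ => by
    rw [norm_smul, hvn, mul_one, norm_mul, T.norm_apply_eq]
  have hp : (0 : ℝ) < (2 : ENNReal).toReal := by norm_num
  have hsum : ∀ (ξ : T.RegularSpace) (t : Finset G),
      ∑ γ ∈ t, ‖F ξ γ‖ ^ (2 : ENNReal).toReal ≤ (C * ‖ξ‖) ^ (2 : ENNReal).toReal := by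
    intro ξ t
    have h1 : ∑ γ ∈ t, ‖F ξ γ‖ ^ (2 : ENNReal).toReal =
        ∑ γ ∈ t with c γ ≠ 0, ‖F ξ γ‖ ^ (2 : ENNReal).toReal := by
      refine (Finset.sum_filter_of_ne ?_).symm
      intro γ _ hγ h0
      apply hγ
      rw [hF, h0, norm_zero, zero_mul, Real.zero_rpow hp.ne']
    -- Injectivity on the support of `c` ensures that no `‖ξ δ‖` is counted twice after reindexing
    -- by `e`.
    have hinj : Set.InjOn e (t.filter fun γ => c γ ≠ 0) :=
      he.mono fun γ hγ => (Finset.mem_filter.1 hγ).2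
    calc _ = ∑ γ ∈ t with c γ ≠ 0, ‖F ξ γ‖ ^ (2 : ENNReal).toReal := h1
      _ ≤ ∑ γ ∈ t with c γ ≠ 0,
          C ^ (2 : ENNReal).toReal * ‖ξ (e γ)‖ ^ (2 : ENNReal).toReal := by
        refine Finset.sum_le_sum fun γ _ => ?_
        rw [hF, ← Real.mul_rpow hC (norm_nonneg _)]
        gcongr
        exact hc γ
      _ = C ^ (2 : ENNReal).toReal *
          ∑ δ ∈ (t.filter fun γ => c γ ≠ 0).image e, ‖ξ δ‖ ^ (2 : ENNReal).toReal := by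
        rw [Finset.sum_image hinj, Finset.mul_sum]
      _ ≤ C ^ (2 : ENNReal).toReal * ‖ξ‖ ^ (2 : ENNReal).toReal := by
        gcongr
        exact lp.sum_rpow_le_norm_rpow hp ξ _
      _ = _ := (Real.mul_rpow hC (norm_nonneg _)).symm
  let L : T.RegularSpace →ₗ[ℂ] T.RegularSpace :=
    { toFun := fun ξ => ⟨F ξ, memℓp_gen' (hsum ξ)⟩
      map_add' := fun ξ η => by
        apply lp.ext
        funext γ
        change (c γ * T.value (ξ + η) (T.lift (e γ))) • v γ = F ξ γ + F η γ
        rw [value_add, mul_add, add_smul]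
      map_smul' := fun k ξ => by
        apply lp.ext
        funext γ
        change (c γ * T.value (k • ξ) (T.lift (e γ))) • v γ = k • F ξ γ
        rw [value_smul, ← smul_assoc, smul_eq_mul, mul_left_comm] }
  refine ⟨L.mkContinuous C fun ξ => lp.norm_le_of_forall_sum_le hp (by positivity) (hsum ξ), ?_⟩
  intro ξ γ
  rw [T.value_eq_eval _ _ (T.proj_lift γ)]
  change Line.eval T (T.lift γ) (T.proj_lift γ) ((c γ * T.value ξ (T.lift (e γ))) • v γ) = _
  rw [map_smul, hv, smul_eq_mul, mul_one]

variable {f : E → ℂ}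

/-- It suffices to check the matrix coefficients on the chosen points over `G`. -/
theorem isConv_of_lift (hf : T.IsEquivariant f) {a : T.RegularSpace →L[ℂ] T.RegularSpace}
    (h1 : ∀ γ δ, s γ = s δ → T.coeff a (T.lift γ) (T.lift δ) = f (T.lift γ * (T.lift δ)⁻¹))
    (h2 : ∀ γ δ, s γ ≠ s δ → T.coeff a (T.lift γ) (T.lift δ) = 0) : T.IsConv f a := by
  constructor
  · intro σ τ h
    obtain ⟨z, hz⟩ := T.exists_act (T.proj_lift (T.proj σ))
    obtain ⟨w, hw⟩ := T.exists_act (T.proj_lift (T.proj τ))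
    have h3 := (T.s_eq_s_iff _ _).1 h
    have h4 : s (T.lift (T.proj σ)) = s (T.lift (T.proj τ)) := by
      rw [T.s_eq_s_iff, T.proj_lift, T.proj_lift, h3]
    rw [← hz, ← hw, T.coeff_act_left, T.coeff_act_right, hf.mul_inv_act T w (by rw [T.s_act, h4]),
      T.act_mul z (h4.trans (r_inv _).symm), hf, h1 _ _ h3]
    ring
  · intro σ τ h
    obtain ⟨z, hz⟩ := T.exists_act (T.proj_lift (T.proj σ))
    obtain ⟨w, hw⟩ := T.exists_act (T.proj_lift (T.proj τ))
    rw [← hz, ← hw, T.coeff_act_left, T.coeff_act_right, h2, zero_mul, zero_mul]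
    rwa [Ne, ← T.s_eq_s_iff]

theorem proj_mul_inv {σ τ : E} (h : s σ = s τ) :
    T.proj (σ * τ⁻¹) = T.proj σ * (T.proj τ)⁻¹ := by
  rw [T.proj_mul _ _ (h.trans (r_inv τ).symm), T.proj_inv]

/-- A bounded section supported on a bisection defines a bounded convolution operator. -/
theorem exists_isConv_of_isBisection (hf : T.IsEquivariant f) {S : Set G} (hS : IsBisection S)
    (hfS : ∀ σ, f σ ≠ 0 → T.proj σ ∈ S) {C : ℝ} (hC : ∀ σ, ‖f σ‖ ≤ C) :
    ∃ a, T.IsConv f a := by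
  classical
  -- The convolution sum at `γ` reduces to the term at `κ⁻¹γ`, where `κ` is the only arrow of `S`
  -- with range `r γ`. The default is harmless because `c` vanishes there.
  let κ : G → G := fun γ => if h : ∃ κ ∈ S, r κ = r γ then h.choose else γ
  have hκ : ∀ γ, (∃ κ ∈ S, r κ = r γ) → κ γ ∈ S ∧ r (κ γ) = r γ := fun γ h => by
    simp only [κ, dif_pos h]
    exact h.choose_spec
  let e : G → G := fun γ => (κ γ)⁻¹ * γ
  let c : G → ℂ := fun γ =>
    if ∃ κ ∈ S, r κ = r γ then f (T.lift γ * (T.lift (e γ))⁻¹) else 0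
  -- The range of `e γ` is the source of `κ γ`, so injectivity of `s` on `S` recovers `κ γ`, and
  -- then `γ = κ γ * e γ`.
  have he : Set.InjOn e {γ | c γ ≠ 0} := by
    intro γ hγ δ hδ hγδ
    have h1 := hκ γ (by by_contra h; exact hγ (if_neg h))
    have h2 := hκ δ (by by_contra h; exact hδ (if_neg h))
    have h3 : s (κ γ) = s (κ δ) := by
      have h := congrArg (r : G → G) hγδ
      simp only [e] at h
      rwa [r_mul _ _ (by rw [s_inv, h1.2]), r_mul _ _ (by rw [s_inv, h2.2]), r_inv, r_inv] at h
    have h4 := hS.2 h1.1 h2.1 h3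
    rw [← mul_inv_cancel_left_eq h1.2, ← mul_inv_cancel_left_eq h2.2]
    change κ γ * e γ = κ δ * e δ
    rw [h4, hγδ]
  have hc : ∀ γ, ‖c γ‖ ≤ C := by
    intro γ
    simp only [c]
    split_ifs
    · exact hC _
    · rw [norm_zero]
      exact (norm_nonneg _).trans (hC (T.lift γ))
  obtain ⟨a, ha⟩ := T.exists_weightedComp c e hc he
  refine ⟨a, T.isConv_of_lift hf ?_ ?_⟩
  · intro γ δ hγδ
    rw [coeff, ha]
    have hsl : s (T.lift γ) = s (T.lift δ) := by
      rw [T.s_eq_s_iff, T.proj_lift, T.proj_lift, hγδ]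
    have hpl : T.proj (T.lift γ * (T.lift δ)⁻¹) = γ * δ⁻¹ := by
      rw [T.proj_mul_inv hsl, T.proj_lift, T.proj_lift]
    by_cases h : ∃ κ ∈ S, r κ = r γ
    · by_cases hδ : e γ = δ
      · rw [hδ, T.value_pointMass, mul_one]
        simp only [c, if_pos h, hδ]
      · rw [T.value_pointMass_of_ne (by rwa [T.proj_lift, T.proj_lift]), mul_zero]
        by_contra hne
        apply hδ
        have h1 := hfS _ (Ne.symm hne)
        rw [hpl] at h1
        have h2 := hκ γ h
        have h5 : s γ = r δ⁻¹ := by rw [r_inv, hγδ]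
        have h3 : κ γ = γ * δ⁻¹ := hS.1 h2.1 h1 (by rw [h2.2, r_mul _ _ h5])
        simp only [e]
        rw [h3, mul_inv_rev_eq h5, inv_inv_eq, inv_mul_cancel_right_eq hγδ.symm]
    · simp only [c, if_neg h, zero_mul]
      by_contra hne
      have h1 := hfS _ (Ne.symm hne)
      rw [hpl] at h1
      exact h ⟨_, h1, r_mul _ _ (by rw [r_inv, hγδ])⟩
  · intro γ δ hγδ
    rw [coeff, ha]
    by_cases h : ∃ κ ∈ S, r κ = r γ
    · rw [T.value_pointMass_of_ne, mul_zero]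
      rw [T.proj_lift, T.proj_lift]
      intro hδ
      apply hγδ
      rw [← hδ]
      exact (s_mul _ _ (by rw [s_inv, (hκ γ h).2])).symm
    · simp only [c, if_neg h, zero_mul]

end

end Twist

/-! ### Products with a factor supported on a bisection -/

namespace Twist

section

open TopologicalGroupoid

variable {G E : Type*} [TopologicalSpace G] [TopologicalGroupoid G]
  [TopologicalSpace E] [TopologicalGroupoid E] (T : Twist G E)
  {a b : T.RegularSpace →L[ℂ] T.RegularSpace} {f g : E → ℂ}

/-- A nonzero term at `ρ'` puts `σρ'⁻¹` over `S` with range `r σ`; injectivity of `r` on `S` leaves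
only `ρ' = ρ⁻¹σ`, up to a phase. -/
theorem IsConv.coeff_mul_eq (ha : T.IsConv f a) {S : Set G} (hS : IsBisection S)
    (hfS : ∀ σ, f σ ≠ 0 → T.proj σ ∈ S) {ρ σ : E} (hρ : T.proj ρ ∈ S) (hr : r ρ = r σ) (τ : E) :
    T.coeff (a * b) σ τ = f ρ * T.coeff b (ρ⁻¹ * σ) τ := by
  have h1 : s ρ⁻¹ = r σ := by rw [s_inv, hr]
  have h2 : s σ = s (ρ⁻¹ * σ) := (s_mul _ _ h1).symm
  rw [T.coeff_mul_of_single a b σ τ (ρ⁻¹ * σ), ha.1 _ _ h2, mul_inv_rev_eq h1, inv_inv_eq,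
    mul_inv_cancel_left_eq hr.symm]
  intro ρ' hρ'
  by_cases h3 : s σ = s ρ'
  · rw [ha.1 _ _ h3]
    by_contra hne
    apply hρ'
    have h4 := hfS _ (left_ne_zero_of_mul hne)
    have h5 : T.proj (σ * ρ'⁻¹) = T.proj ρ := hS.1 h4 hρ (by
      rw [← T.r_eq_r_iff, r_mul _ _ (h3.trans (r_inv _).symm), hr])
    rw [T.proj_mul _ _ h1, T.proj_inv, ← h5, ← T.proj_inv, ← T.proj_mul _ _ (by
      rw [s_inv, r_mul _ _ (h3.trans (r_inv _).symm)]), mul_inv_rev_eq (h3.trans (r_inv _).symm),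
      inv_inv_eq, inv_mul_cancel_right_eq h3.symm]
  · rw [ha.2 _ _ h3, zero_mul]

theorem IsConv.coeff_mul_eq_zero (ha : T.IsConv f a) {S : Set G}
    (hfS : ∀ σ, f σ ≠ 0 → T.proj σ ∈ S) {σ : E} (hσ : ∀ ρ, T.proj ρ ∈ S → r ρ ≠ r σ) (τ : E) :
    T.coeff (a * b) σ τ = 0 := by
  apply T.coeff_mul_eq_zero
  intro ρ
  by_cases h3 : s σ = s ρ
  · rw [ha.1 _ _ h3]
    by_contra hne
    exact hσ _ (hfS _ (left_ne_zero_of_mul hne)) (r_mul _ _ (h3.trans (r_inv _).symm))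
  · rw [ha.2 _ _ h3, zero_mul]

theorem IsConv.sectionOf_mul_eq (ha : T.IsConv f a) (hb : T.IsConv g b) {S : Set G}
    (hS : IsBisection S) (hfS : ∀ σ, f σ ≠ 0 → T.proj σ ∈ S) {ρ σ : E} (hρ : T.proj ρ ∈ S)
    (hr : r ρ = r σ) : T.sectionOf (a * b) σ = f ρ * g (ρ⁻¹ * σ) := by
  have h1 : s (ρ⁻¹ * σ) = s σ := s_mul _ _ (by rw [s_inv, hr])
  rw [T.sectionOf_eq_coeff, ha.coeff_mul_eq T hS hfS hρ hr, hb.1 _ _ (by rw [h1, s_s]),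
    ← h1, mul_inv_s]

/-- Passing from `σ` to `ρ⁻¹σ` commutes with right translation by `τ⁻¹`. -/
theorem IsConv.mul_of_isBisection (ha : T.IsConv f a) (hb : T.IsConv g b) {S : Set G}
    (hS : IsBisection S) (hfS : ∀ σ, f σ ≠ 0 → T.proj σ ∈ S) :
    T.IsConv (T.sectionOf (a * b)) (a * b) := by
  constructor
  · intro σ τ h
    have h2 : s σ = r τ⁻¹ := h.trans (r_inv τ).symm
    by_cases hσ : ∃ ρ, T.proj ρ ∈ S ∧ r ρ = r σ
    · obtain ⟨ρ, hρ, hr⟩ := hσ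
      have h1 : s ρ⁻¹ = r σ := by rw [s_inv, hr]
      rw [ha.coeff_mul_eq T hS hfS hρ hr,
        ha.sectionOf_mul_eq T hb hS hfS hρ (hr.trans (r_mul _ _ h2).symm),
        hb.1 _ _ ((s_mul _ _ h1).trans h), mul_assoc_eq _ _ _ h1 h2]
    · push Not at hσ
      rw [ha.coeff_mul_eq_zero T hfS hσ, T.sectionOf_eq_coeff, ha.coeff_mul_eq_zero T hfS]
      rwa [r_mul _ _ h2]
  · intro σ τ h
    by_cases hσ : ∃ ρ, T.proj ρ ∈ S ∧ r ρ = r σ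
    · obtain ⟨ρ, hρ, hr⟩ := hσ
      rw [ha.coeff_mul_eq T hS hfS hρ hr, hb.2, mul_zero]
      rwa [s_mul _ _ (by rw [s_inv, hr])]
    · push Not at hσ
      rw [ha.coeff_mul_eq_zero T hfS hσ]

/-- The value at `σ` is `f ρ * g (ρ⁻¹σ)` for any `ρ` over `U` with `r ρ = r σ`. No continuous choice
of `ρ` is needed: the expression is jointly continuous, and openness of `proj` and of the range map
supplies a suitable `ρ` near `ρ₀` for each `σ` near `σ₀`. -/
theorem IsConv.continuous_sectionOf_mul [T2Space G] (hG : IsEtale G) (ha : T.IsConv f a)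
    (hb : T.IsConv g b) (hf : Continuous f) (hg : Continuous g) {U K : Set G} (hU : IsOpen U)
    (hUb : IsBisection U) (hK : IsCompact K) (hKU : K ⊆ U)
    (hfK : ∀ σ, f σ ≠ 0 → T.proj σ ∈ K) : Continuous (T.sectionOf (a * b)) := by
  rw [continuous_iff_continuousAt]
  intro σ₀
  by_cases h0 : r (T.proj σ₀) ∈ r '' K
  · obtain ⟨κ, hκ, hr⟩ := h0
    obtain ⟨ρ₀, rfl⟩ := T.surjective_proj κ
    have hr' : r ρ₀ = r σ₀ := (T.r_eq_r_iff _ _).2 hr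
    have hUf : ∀ σ, f σ ≠ 0 → T.proj σ ∈ U := fun σ hσ => hKU (hfK σ hσ)
    have hΦ : ContinuousOn (fun p : E × E => f p.1 * g (p.1⁻¹ * p.2)) {p | r p.1 = r p.2} := by
      refine (hf.comp continuous_fst).continuousOn.mul (hg.comp_continuousOn ?_)
      refine continuousOn_mul.comp (f := fun p : E × E => (p.1⁻¹, p.2))
        ((continuous_inv'.comp continuous_fst).prodMk continuous_snd).continuousOn ?_
      intro p hp
      exact (s_inv p.1).trans hp
    rw [ContinuousAt, ha.sectionOf_mul_eq T hb hUb hUf (hKU hκ) hr']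
    rw [Filter.tendsto_def]
    intro N hN
    have h1 := (hΦ (ρ₀, σ₀) hr').preimage_mem_nhdsWithin hN
    rw [mem_nhdsWithin_iff_exists_mem_nhds_inter] at h1
    obtain ⟨W, hW, hWN⟩ := h1
    rw [nhds_prod_eq, Filter.mem_prod_iff] at hW
    obtain ⟨u, hu, v, hv, huv⟩ := hW
    have hu' : u ∩ T.proj ⁻¹' U ∈ nhds ρ₀ :=
      Filter.inter_mem hu ((hU.preimage T.continuous_proj).mem_nhds (hKU hκ))
    have h2 := hG.isLocalHomeomorph_rangeMap.isOpenMap.image_mem_nhds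
      (T.isOpenMap_proj.image_mem_nhds hu')
    have h3 : (rangeMap (T.proj ρ₀) : unitSpace G) = rangeMap (T.proj σ₀) := Subtype.ext hr
    rw [h3] at h2
    have h4 := (continuous_rangeMap.comp T.continuous_proj).continuousAt.preimage_mem_nhds
      (x := σ₀) h2
    filter_upwards [h4, hv] with σ hσ hσv
    obtain ⟨_, ⟨ρ, ⟨hρu, hρU⟩, rfl⟩, hρ⟩ := hσ
    have hρr : r ρ = r σ := (T.r_eq_r_iff _ _).2 (congrArg Subtype.val hρ)
    change T.sectionOf (a * b) σ ∈ N
    rw [ha.sectionOf_mul_eq T hb hUb hUf hρU hρr]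
    exact hWN ⟨huv (Set.mk_mem_prod hρu hσv), hρr⟩
  -- `r(K)` is compact, hence closed, and the product vanishes at every `σ` whose range lies outside
  -- it.
  · have hcl : IsClosed ((fun σ => r (T.proj σ)) ⁻¹' (r '' K)) :=
      (hK.image continuous_r).isClosed.preimage (continuous_r.comp T.continuous_proj)
    have hev : T.sectionOf (a * b) =ᶠ[nhds σ₀] fun _ => 0 := by
      filter_upwards [hcl.isOpen_compl.mem_nhds h0] with σ hσ
      rw [T.sectionOf_eq_coeff]
      apply ha.coeff_mul_eq_zero T hfK
      intro ρ hρ hr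
      exact hσ ⟨_, hρ, (T.r_eq_r_iff _ _).1 hr⟩
    exact continuousAt_const.congr hev.symm

theorem IsConv.exists_isCompact_sectionOf_mul [T2Space G] (ha : T.IsConv f a)
    (hb : T.IsConv g b) {K K' : Set G} (hS : IsBisection K) (hK : IsCompact K)
    (hfK : ∀ σ, f σ ≠ 0 → T.proj σ ∈ K) (hK' : IsCompact K')
    (hgK : ∀ σ, g σ ≠ 0 → T.proj σ ∈ K') :
    ∃ K'' : Set G, IsCompact K'' ∧ ∀ σ, T.sectionOf (a * b) σ ≠ 0 → T.proj σ ∈ K'' := by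
  refine ⟨(fun p : G × G => p.1 * p.2) '' ((K ×ˢ K') ∩ {p | s p.1 = r p.2}), ?_, ?_⟩
  · apply IsCompact.image_of_continuousOn
    · exact (hK.prod hK').inter_right
        (isClosed_eq (continuous_s.comp continuous_fst) (continuous_r.comp continuous_snd))
    · exact continuousOn_mul.mono Set.inter_subset_right
  · intro σ hσ
    by_cases h : ∃ ρ, T.proj ρ ∈ K ∧ r ρ = r σ
    · obtain ⟨ρ, hρ, hr⟩ := h
      rw [ha.sectionOf_mul_eq T hb hS hfK hρ hr] at hσ
      have h1 : s ρ⁻¹ = r σ := by rw [s_inv, hr]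
      have h2 : s ρ = r (ρ⁻¹ * σ) := by rw [r_mul _ _ h1, r_inv]
      refine ⟨(T.proj ρ, T.proj (ρ⁻¹ * σ)), ⟨⟨hρ, hgK _ (right_ne_zero_of_mul hσ)⟩, ?_⟩, ?_⟩
      · exact (T.s_eq_r_iff _ _).1 h2
      · change T.proj ρ * T.proj (ρ⁻¹ * σ) = T.proj σ
        rw [← T.proj_mul _ _ h2, mul_inv_cancel_left_eq hr]
    · push Not at h
      exact absurd (ha.coeff_mul_eq_zero T hfK h _) hσ

/-! ### Compactly supported sections -/

theorem IsCompactSection.isEquivariant (hf : T.IsCompactSection f) : T.IsEquivariant f := hf.2.1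

theorem IsCompactSection.add (hf : T.IsCompactSection f) (hg : T.IsCompactSection g) :
    T.IsCompactSection (f + g) := by
  obtain ⟨hf1, hf2, K, hK, hfK⟩ := hf
  obtain ⟨hg1, hg2, K', hK', hgK⟩ := hg
  refine ⟨hf1.add hg1, fun z σ => ?_, K ∪ K', hK.union hK', fun σ hσ => ?_⟩
  · simp only [Pi.add_apply]
    rw [hf2, hg2, add_mul]
  · by_contra h
    rw [Set.mem_union, not_or] at h
    apply hσ
    rw [Pi.add_apply, not_not.1 (mt (hfK σ) h.1), not_not.1 (mt (hgK σ) h.2), add_zero]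

theorem IsCompactSection.smul (c : ℂ) (hf : T.IsCompactSection f) :
    T.IsCompactSection (c • f) := by
  obtain ⟨hf1, hf2, K, hK, hfK⟩ := hf
  refine ⟨hf1.const_smul c, fun z σ => ?_, K, hK, fun σ hσ => hfK σ (right_ne_zero_of_mul hσ)⟩
  simp only [Pi.smul_apply, smul_eq_mul]
  rw [hf2, mul_assoc]

theorem isCompactSection_zero : T.IsCompactSection 0 :=
  ⟨continuous_zero, fun z σ => by simp, ∅, isCompact_empty, fun σ hσ => absurd rfl hσ⟩

theorem IsCompactSection.star (hf : T.IsCompactSection f) :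
    T.IsCompactSection (fun σ => conj (f σ⁻¹)) := by
  obtain ⟨hf1, hf2, K, hK, hfK⟩ := hf
  refine ⟨Complex.continuous_conj.comp (hf1.comp continuous_inv'), fun z σ => ?_,
    (fun γ => γ⁻¹) '' K, hK.image continuous_inv', fun σ hσ => ?_⟩
  · dsimp only
    rw [T.inv_act, hf2, coe_inv_circle, map_mul, Complex.conj_conj]
  · refine ⟨T.proj σ⁻¹, hfK _ fun h => hσ (by simp only [h, map_zero]), ?_⟩
    simp only
    rw [T.proj_inv, inv_inv_eq]

theorem IsEquivariant.norm_eq (hf : T.IsEquivariant f) {σ τ : E} (h : T.proj σ = T.proj τ) :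
    ‖f σ‖ = ‖f τ‖ := by
  obtain ⟨z, rfl⟩ := T.exists_act h
  rw [hf, norm_mul, RCLike.norm_conj, Circle.norm_coe, mul_one]

/-- Compactness is given in `G`, whereas `f` lives on `E`; but `|f|` is constant on fibers and
`proj` is open, so local bounds descend to `G`. -/
theorem IsCompactSection.exists_bound (hf : T.IsCompactSection f) : ∃ C, ∀ σ, ‖f σ‖ ≤ C := by
  obtain ⟨hf1, hf2, K, hK, hfK⟩ := hf
  have key : ∃ C, ∀ σ, T.proj σ ∈ K → ‖f σ‖ ≤ C := by
    refine hK.induction_on (p := fun s => ∃ C, ∀ σ, T.proj σ ∈ s → ‖f σ‖ ≤ C)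
      ⟨0, fun σ hσ => hσ.elim⟩ ?_ ?_ ?_
    · rintro s t hst ⟨C, hC⟩
      exact ⟨C, fun σ hσ => hC σ (hst hσ)⟩
    · rintro s t ⟨C, hC⟩ ⟨D, hD⟩
      refine ⟨max C D, fun σ hσ => ?_⟩
      rcases hσ with hσ | hσ
      · exact (hC σ hσ).trans (le_max_left _ _)
      · exact (hD σ hσ).trans (le_max_right _ _)
    · intro γ _
      obtain ⟨σ₀, rfl⟩ := T.surjective_proj γ
      have hV : {σ | ‖f σ‖ < ‖f σ₀‖ + 1} ∈ nhds σ₀ :=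
        (isOpen_lt hf1.norm continuous_const).mem_nhds (by simp)
      refine ⟨_, mem_nhdsWithin_of_mem_nhds (T.isOpenMap_proj.image_mem_nhds hV),
        ‖f σ₀‖ + 1, ?_⟩
      rintro σ ⟨τ, hτ, hτσ⟩
      rw [← IsEquivariant.norm_eq T hf2 hτσ]
      exact hτ.le
  obtain ⟨C, hC⟩ := key
  refine ⟨max C 0, fun σ => ?_⟩
  by_cases h : f σ = 0
  · rw [h, norm_zero]
    exact le_max_right _ _
  · exact (hC σ (hfK σ h)).trans (le_max_left _ _)

/-- A compactly supported section whose support is contained in an open bisection. -/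
def IsBisectionSection (f : E → ℂ) : Prop :=
  Continuous f ∧ T.IsEquivariant f ∧ ∃ U K : Set G, IsOpen U ∧ IsBisection U ∧ IsCompact K ∧
    K ⊆ U ∧ ∀ σ, f σ ≠ 0 → T.proj σ ∈ K

theorem IsBisectionSection.isCompactSection (hf : T.IsBisectionSection f) :
    T.IsCompactSection f := by
  obtain ⟨h1, h2, U, K, -, -, hK, -, hfK⟩ := hf
  exact ⟨h1, h2, K, hK, hfK⟩

theorem IsBisectionSection.exists_isConv (hf : T.IsBisectionSection f) : ∃ a, T.IsConv f a := by
  obtain ⟨C, hC⟩ := hf.isCompactSection.exists_bound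
  obtain ⟨h1, h2, U, K, -, hU, -, hKU, hfK⟩ := hf
  exact T.exists_isConv_of_isBisection h2 hU (fun σ hσ => hKU (hfK σ hσ)) hC

/-- Every compactly supported section is a finite sum of sections supported on open bisections. -/
theorem IsCompactSection.exists_sum [T2Space G] [LocallyCompactSpace G] (hG : IsEtale G)
    (hf : T.IsCompactSection f) :
    ∃ (n : ℕ) (F : Fin n → E → ℂ), (∀ i, T.IsBisectionSection (F i)) ∧ f = ∑ i, F i := by
  obtain ⟨hf1, hf2, K, hK, hfK⟩ := hf
  choose U hU hγU hUb using hG.exists_isBisection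
  obtain ⟨t, ht⟩ := hK.elim_finite_subcover U hU fun γ _ => Set.mem_iUnion.2 ⟨γ, hγU γ⟩
  have hcov : K ⊆ ⋃ i : Fin t.card, U (t.equivFin.symm i) := by
    intro γ hγ
    obtain ⟨δ, hδ, hγδ⟩ := Set.mem_iUnion₂.1 (ht hγ)
    refine Set.mem_iUnion.2 ⟨t.equivFin ⟨δ, hδ⟩, ?_⟩
    simpa using hγδ
  -- The partition of unity is taken on `G` and pulled back, so that multiplying by it preserves
  -- equivariance.
  obtain ⟨χ, hχU, hχ1, -, hχc⟩ :=
    exists_continuous_sum_one_of_isOpen_isCompact (fun i => hU (t.equivFin.symm i)) hK hcov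
  refine ⟨_, fun i σ => (χ i (T.proj σ) : ℂ) * f σ, fun i => ⟨?_, ?_, U (t.equivFin.symm i),
    tsupport (χ i), hU _, hUb _, hχc i, hχU i, ?_⟩, ?_⟩
  · exact (Complex.continuous_ofReal.comp ((χ i).continuous.comp T.continuous_proj)).mul hf1
  · intro z σ
    dsimp only
    rw [T.proj_act, hf2, mul_assoc]
  · intro σ hσ
    apply subset_tsupport
    have h := left_ne_zero_of_mul hσ
    exact_mod_cast h
  · funext σ
    rw [Finset.sum_apply, ← Finset.sum_mul]
    by_cases h : f σ = 0
    · rw [h, mul_zero]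
    · have h1 := hχ1 (hfK σ h)
      rw [Finset.sum_apply, Pi.one_apply] at h1
      have h2 : ∑ i, (χ i (T.proj σ) : ℂ) = 1 := by exact_mod_cast h1
      rw [h2, one_mul]

/-! ### The reduced algebra is a C⋆-algebra -/

/-- The space of the operators of the regular representation of `C_c(G, E)`. -/
noncomputable def compactSubmodule : Submodule ℂ (T.RegularSpace →L[ℂ] T.RegularSpace) where
  carrier := {a | ∃ f, T.IsCompactSection f ∧ T.IsRegularRep f a}
  add_mem' := by
    rintro a b ⟨f, hf, ha⟩ ⟨g, hg, hb⟩
    rw [T.isRegularRep_iff_isConv hf.isEquivariant] at ha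
    rw [T.isRegularRep_iff_isConv hg.isEquivariant] at hb
    exact ⟨f + g, hf.add T hg,
      (T.isRegularRep_iff_isConv (hf.add T hg).isEquivariant).2 (ha.add T hb)⟩
  zero_mem' := ⟨0, T.isCompactSection_zero,
    (T.isRegularRep_iff_isConv T.isCompactSection_zero.isEquivariant).2 T.isConv_zero⟩
  smul_mem' := by
    rintro c a ⟨f, hf, ha⟩
    rw [T.isRegularRep_iff_isConv hf.isEquivariant] at ha
    exact ⟨c • f, hf.smul T c,
      (T.isRegularRep_iff_isConv (hf.smul T c).isEquivariant).2 (ha.smul T c)⟩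

theorem mem_compactSubmodule :
    a ∈ T.compactSubmodule ↔ ∃ f, T.IsCompactSection f ∧ T.IsConv f a :=
  exists_congr fun _ => and_congr_right fun hf => T.isRegularRep_iff_isConv hf.isEquivariant

variable {T} in
theorem exists_sum_of_mem_compactSubmodule [T2Space G] [LocallyCompactSpace G] (hG : IsEtale G)
    (ha : a ∈ T.compactSubmodule) :
    ∃ (n : ℕ) (F : Fin n → E → ℂ) (c : Fin n → T.RegularSpace →L[ℂ] T.RegularSpace),
      (∀ i, T.IsBisectionSection (F i)) ∧ (∀ i, T.IsConv (F i) (c i)) ∧ a = ∑ i, c i := by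
  obtain ⟨f, hf, ha⟩ := T.mem_compactSubmodule.1 ha
  obtain ⟨n, F, hF, rfl⟩ := hf.exists_sum T hG
  choose c hc using fun i => (hF i).exists_isConv T
  refine ⟨n, F, c, hF, hc, T.ext_coeff fun σ τ => ?_⟩
  rw [T.coeff_sum]
  by_cases h : s σ = s τ
  · rw [ha.1 _ _ h, Finset.sum_apply]
    exact Finset.sum_congr rfl fun i _ => ((hc i).1 _ _ h).symm
  · rw [ha.2 _ _ h]
    exact (Finset.sum_eq_zero fun i _ => (hc i).2 _ _ h).symm

variable [T2Space G] [LocallyCompactSpace G] (hG : IsEtale G)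

/-- The image of `C_c(G, E)` under the regular representation, as a `⋆`-algebra. -/
noncomputable def compactAlgebra : NonUnitalStarSubalgebra ℂ (T.RegularSpace →L[ℂ] T.RegularSpace) where
  toSubmodule := T.compactSubmodule
  mul_mem' := by
    intro a b ha hb
    change a * b ∈ T.compactSubmodule
    -- Splitting the left factor alone suffices for the one-term product formula.
    obtain ⟨n, F, c, hF, hc, rfl⟩ := exists_sum_of_mem_compactSubmodule hG ha
    obtain ⟨g, hg, hb⟩ := T.mem_compactSubmodule.1 hb
    rw [Finset.sum_mul]
    refine Submodule.sum_mem _ fun i _ => T.mem_compactSubmodule.2 ?_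
    obtain ⟨h1, h2, U, K, hU, hUb, hK, hKU, hFK⟩ := hF i
    obtain ⟨h3, h4, K', hK', hgK⟩ := hg
    exact ⟨_, ⟨(hc i).continuous_sectionOf_mul T hG hb h1 h3 hU hUb hK hKU hFK,
      T.isEquivariant_sectionOf _,
      (hc i).exists_isCompact_sectionOf_mul T hb (hUb.mono hKU) hK hFK hK' hgK⟩,
      (hc i).mul_of_isBisection T hb (hUb.mono hKU) hFK⟩
  star_mem' := by
    intro a ha
    obtain ⟨f, hf, ha⟩ := T.mem_compactSubmodule.1 ha
    exact T.mem_compactSubmodule.2 ⟨_, hf.star T, ha.star T⟩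

/-- `C⋆_r(G, E)` as a `⋆`-subalgebra of the bounded operators. -/
noncomputable def reducedStarAlgebra : NonUnitalStarSubalgebra ℂ (T.RegularSpace →L[ℂ] T.RegularSpace) :=
  (T.compactAlgebra hG).topologicalClosure

theorem coe_reducedStarAlgebra : (T.reducedStarAlgebra hG : Set _) = T.reducedAlgebra := rfl

end

end Twist

/-! ### Cutoff functions in `C₀(X)` -/

section

variable {X : Type*} [TopologicalSpace X]

/-- A continuous function with compact support, as an element of `C₀(X)`. -/
theorem exists_zeroAtInfty_of_hasCompactSupport (f : C(X, ℂ)) (hf : HasCompactSupport f) :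
    ∃ u : C₀(X, ℂ), ∀ x, u x = f x :=
  ⟨⟨f, hf.is_zero_at_infty⟩, fun _ => rfl⟩

theorem exists_zeroAtInfty_one_zero [T2Space X] [LocallyCompactSpace X] {x : X} {V : Set X}
    (hV : V ∈ nhds x) : ∃ u : C₀(X, ℂ), u x = 1 ∧ ∀ y ∉ V, u y = 0 := by
  obtain ⟨V', hV', hV'o, hx⟩ := mem_nhds_iff.1 hV
  obtain ⟨χ, h1, h0, hc, -⟩ := exists_continuous_one_zero_of_isCompact
    (isCompact_singleton (x := x)) hV'o.isClosed_compl
    (Set.disjoint_singleton_left.2 fun h => h hx)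
  obtain ⟨u, hu⟩ := exists_zeroAtInfty_of_hasCompactSupport
    (⟨fun x => (χ x : ℂ), by fun_prop⟩ : C(X, ℂ))
    (hc.comp_left (g := Complex.ofReal) Complex.ofReal_zero)
  refine ⟨u, ?_, fun y hy => ?_⟩
  · rw [hu]
    change ((χ x : ℝ) : ℂ) = 1
    rw [h1 rfl]; simp
  · rw [hu]
    change ((χ y : ℝ) : ℂ) = 0
    rw [h0 fun h => hy (hV' h)]; simp

theorem norm_le_of_forall_norm_apply_le (u : C₀(X, ℂ)) {C : ℝ} (hC : 0 ≤ C)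
    (h : ∀ x, ‖u x‖ ≤ C) : ‖u‖ ≤ C := by
  rw [← ZeroAtInftyContinuousMap.norm_toBCF_eq_norm]
  exact (BoundedContinuousFunction.norm_le hC).2 h

/-- Functions vanishing at infinity are approximated by functions with compact support. -/
theorem exists_zeroAtInfty_norm_sub_le [T2Space X] [LocallyCompactSpace X] (u : C₀(X, ℂ)) {ε : ℝ}
    (hε : 0 < ε) :
    ∃ v : C₀(X, ℂ), ‖u - v‖ ≤ ε ∧ ∃ K : Set X, IsCompact K ∧ ∀ x ∉ K, v x = 0 := by
  have h1 : ∀ᶠ x in Filter.cocompact X, ‖u x‖ < ε := by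
    have h := (zero_at_infty u).norm
    rw [norm_zero] at h
    exact h.eventually_lt_const hε
  obtain ⟨K, hK, hKu⟩ := Filter.mem_cocompact.1 h1
  obtain ⟨χ, hχ1, -, hc, hχ⟩ := exists_continuous_one_zero_of_isCompact hK
    (isClosed_empty (X := X)) (Set.disjoint_empty _)
  have hc' : HasCompactSupport fun x => (χ x : ℂ) * u x :=
    (hc.comp_left (g := Complex.ofReal) Complex.ofReal_zero).mul_right
  obtain ⟨v, hv⟩ := exists_zeroAtInfty_of_hasCompactSupport
    (⟨fun x => (χ x : ℂ) * u x, by fun_prop⟩ : C(X, ℂ)) hc'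
  have hv' : ∀ x, v x = (χ x : ℂ) * u x := hv
  refine ⟨v, norm_le_of_forall_norm_apply_le _ hε.le fun x => ?_, tsupport χ, hc, fun x hx => ?_⟩
  · rw [ZeroAtInftyContinuousMap.sub_apply, hv']
    by_cases hx : x ∈ K
    · rw [hχ1 hx]
      simp [hε.le]
    · have h2 : u x - (χ x : ℂ) * u x = ((1 - χ x : ℝ) : ℂ) * u x := by
        push_cast; ring
      rw [h2, norm_mul, Complex.norm_real, Real.norm_eq_abs,
        abs_of_nonneg (sub_nonneg.2 (hχ x).2)]
      have h3 : ‖u x‖ < ε := hKu hx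
      nlinarith [(hχ x).1, norm_nonneg (u x)]
  · rw [hv', image_eq_zero_of_notMem_tsupport hx]
    simp

end

/-! ### Sections of elements of the completion, and the diagonal -/

namespace Twist

section

open TopologicalGroupoid

variable {G E : Type*} [TopologicalSpace G] [TopologicalGroupoid G]
  [TopologicalSpace E] [TopologicalGroupoid E] (T : Twist G E)
  {a b : T.RegularSpace →L[ℂ] T.RegularSpace} {f g : E → ℂ}

/-! ### Sections of elements of the reduced algebra -/

theorem exists_norm_sub_lt (ha : a ∈ T.reducedAlgebra) {ε : ℝ} (hε : 0 < ε) :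
    ∃ f b, T.IsCompactSection f ∧ T.IsConv f b ∧ ‖a - b‖ < ε := by
  obtain ⟨b, ⟨f, hf, hb⟩, hab⟩ := Metric.mem_closure_iff.1 ha ε hε
  rw [dist_eq_norm] at hab
  exact ⟨f, b, hf, (T.isRegularRep_iff_isConv hf.isEquivariant).1 hb, hab⟩

theorem isConv_of_mem (ha : a ∈ T.reducedAlgebra) : T.IsConv (T.sectionOf a) a := by
  have hcl : IsClosed {a | T.IsConv (T.sectionOf a) a} := by
    have : {a | T.IsConv (T.sectionOf a) a} =
        {a | ∀ σ τ, s σ = s τ → T.coeff a σ τ = T.coeff a (σ * τ⁻¹) (s (σ * τ⁻¹))} ∩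
          {a | ∀ σ τ, s σ ≠ s τ → T.coeff a σ τ = 0} := rfl
    rw [this]
    simp only [Set.ofPred_forall]
    refine IsClosed.inter ?_ ?_
    · exact isClosed_iInter fun σ => isClosed_iInter fun τ => isClosed_iInter fun _ =>
        isClosed_eq (T.continuous_coeff _ _) (T.continuous_coeff _ _)
    · exact isClosed_iInter fun σ => isClosed_iInter fun τ => isClosed_iInter fun _ =>
        isClosed_eq (T.continuous_coeff _ _) continuous_const
  refine closure_minimal ?_ hcl ha
  rintro b ⟨f, hf, hb⟩
  rw [T.isRegularRep_iff_isConv hf.isEquivariant] at hb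
  change T.IsConv _ _
  rwa [hb.sectionOf_eq]

/-- Norm approximation of operators is uniform approximation of sections; continuity and decay at
infinity pass to the completion this way. -/
theorem norm_sectionOf_sub_le (hb : T.IsConv f b) (σ : E) :
    ‖T.sectionOf a σ - f σ‖ ≤ ‖a - b‖ := by
  rw [← hb.sectionOf_eq, T.sectionOf_eq_coeff, T.sectionOf_eq_coeff, ← T.coeff_sub]
  exact T.norm_coeff_le _ _ _

theorem continuous_sectionOf (ha : a ∈ T.reducedAlgebra) : Continuous (T.sectionOf a) := by
  refine _root_.continuous_of_uniform_approx_of_continuous ?_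
  intro u hu
  obtain ⟨ε, hε, hεu⟩ := Metric.mem_uniformity_dist.1 hu
  obtain ⟨f, b, hf, hb, hab⟩ := T.exists_norm_sub_lt ha hε
  refine ⟨f, hf.1, fun σ => hεu ?_⟩
  rw [dist_eq_norm]
  exact (T.norm_sectionOf_sub_le hb σ).trans_lt hab

theorem isOpen_openSupport (ha : a ∈ T.reducedAlgebra) : IsOpen (T.openSupport a) := by
  have h : T.openSupport a = T.proj '' {σ | T.sectionOf a σ ≠ 0} := by
    ext γ
    exact exists_congr fun σ => and_comm
  rw [h]
  exact T.isOpenMap_proj _ (isOpen_ne_fun (T.continuous_sectionOf ha) continuous_const)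

theorem continuous_incl_one : Continuous fun x : unitSpace G => T.incl (1, x) :=
  T.incl_isEmbedding.continuous.comp (by fun_prop)

/-- The restriction to the unit space of the section of an element of the reduced algebra. -/
theorem exists_zeroAtInfty_eq_coeff [T2Space G] (ha : a ∈ T.reducedAlgebra) :
    ∃ u : C₀(unitSpace G, ℂ), ∀ x, u x = T.coeff a (T.incl (1, x)) (T.incl (1, x)) := by
  have h1 : ∀ x : unitSpace G, T.sectionOf a (T.incl (1, x)) =
      T.coeff a (T.incl (1, x)) (T.incl (1, x)) := fun x => by
    rw [T.sectionOf_eq_coeff, T.s_incl]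
  have h0 : Filter.Tendsto (fun x : unitSpace G => T.sectionOf a (T.incl (1, x)))
      (Filter.cocompact _) (nhds 0) := by
    rw [Metric.tendsto_nhds]
    intro ε hε
    obtain ⟨f, b, ⟨-, -, K, hK, hfK⟩, hb, hab⟩ := T.exists_norm_sub_lt ha hε
    have hK' : IsCompact ((Subtype.val : unitSpace G → G) ⁻¹' K) :=
      (isClosed_unitSpace.isClosedEmbedding_subtypeVal).isCompact_preimage hK
    filter_upwards [hK'.compl_mem_cocompact] with x hx
    have h2 : f (T.incl (1, x)) = 0 := by
      by_contra h
      have h3 := hfK _ h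
      rw [T.proj_incl] at h3
      exact hx h3
    have h3 := T.norm_sectionOf_sub_le (a := a) hb (T.incl (1, x))
    rw [h2] at h3
    rw [dist_eq_norm]
    exact h3.trans_lt hab
  exact ⟨⟨⟨_, (T.continuous_sectionOf ha).comp T.continuous_incl_one⟩, h0⟩, h1⟩

/-! ### The diagonal -/

theorem coeff_diag (h : C₀(unitSpace G, ℂ)) (σ τ : E) :
    T.coeff (T.diag h) σ τ = h (rangeMap (T.proj σ)) * T.value (T.pointMass τ) σ := rfl

theorem sectionOf_diag_mul (h : C₀(unitSpace G, ℂ)) (σ : E) :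
    T.sectionOf (T.diag h * a) σ = h (rangeMap (T.proj σ)) * T.sectionOf a σ := rfl

theorem coeff_diag_of_ne (h : C₀(unitSpace G, ℂ)) {σ τ : E} (hστ : T.proj σ ≠ T.proj τ) :
    T.coeff (T.diag h) σ τ = 0 := by
  rw [coeff_diag, T.value_pointMass_of_ne hστ, mul_zero]

theorem coeff_diag_act (h : C₀(unitSpace G, ℂ)) (z : Circle) (σ : E) :
    T.coeff (T.diag h) (T.act z σ) σ = h (rangeMap (T.proj σ)) * conj (z : ℂ) := by
  rw [coeff_diag, T.value_pointMass_self, T.proj_act]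

theorem coeff_diag_self (h : C₀(unitSpace G, ℂ)) (x : unitSpace G) :
    T.coeff (T.diag h) (T.incl (1, x)) (T.incl (1, x)) = h x := by
  have h1 := T.sectionOf_diag_incl h 1 x
  rwa [T.sectionOf_eq_coeff, T.s_incl, Circle.coe_one, map_one, mul_one] at h1

theorem isConv_diag (h : C₀(unitSpace G, ℂ)) : T.IsConv (T.sectionOf (T.diag h)) (T.diag h) := by
  constructor
  · intro σ τ hst
    by_cases hp : T.proj σ = T.proj τ
    · obtain ⟨z, rfl⟩ := T.exists_act hp.symm
      have h1 : T.act z τ * τ⁻¹ = T.act z (r τ) := by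
        rw [T.act_mul z (r_inv τ).symm, mul_inv_eq]
      rw [h1, T.sectionOf_eq_coeff, T.s_act, s_r, T.coeff_diag_act, T.coeff_diag_act]
      congr 2
      exact Subtype.ext (by change r _ = r _; rw [T.proj_r, r_r])
    · rw [T.coeff_diag_of_ne h hp, T.sectionOf_diag_of_notMem]
      rw [T.proj_mul_inv hst]
      exact fun hu => hp (eq_of_mul_inv_mem_unitSpace ((T.s_eq_s_iff _ _).1 hst) hu)
  · intro σ τ hst
    apply T.coeff_diag_of_ne
    intro hc
    exact hst ((T.s_eq_s_iff _ _).2 (by rw [hc]))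

/-- An element of the reduced algebra with a diagonal matrix belongs to `C₀(G⁽⁰⁾)`. -/
theorem exists_diag_eq [T2Space G] (ha : a ∈ T.reducedAlgebra)
    (hd : ∀ σ τ, T.proj σ ≠ T.proj τ → T.coeff a σ τ = 0) :
    ∃ u : C₀(unitSpace G, ℂ), T.diag u = a ∧
      ∀ x, u x = T.coeff a (T.incl (1, x)) (T.incl (1, x)) := by
  obtain ⟨u, hu⟩ := T.exists_zeroAtInfty_eq_coeff ha
  refine ⟨u, T.ext_coeff fun σ τ => ?_, hu⟩
  by_cases hp : T.proj σ = T.proj τ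
  · obtain ⟨z, rfl⟩ := T.exists_act hp.symm
    have h1 := (T.isConv_of_mem ha).1 τ τ rfl
    rw [T.coeff_diag_act, T.coeff_act_left, h1, hu, mul_inv_eq, T.r_eq, T.sectionOf_eq_coeff,
      T.s_incl]
  · rw [hd _ _ hp, T.coeff_diag_of_ne u hp]

theorem norm_diag (h : C₀(unitSpace G, ℂ)) : ‖T.diag h‖ = ‖h‖ := by
  apply le_antisymm
  · exact NonUnitalStarAlgHom.norm_apply_le T.diag h
  · refine norm_le_of_forall_norm_apply_le _ (norm_nonneg _) fun x => ?_
    rw [← T.coeff_diag_self h x]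
    exact T.norm_coeff_le _ _ _

theorem diag_injective : Function.Injective T.diag := by
  intro h k hk
  ext x
  rw [← T.coeff_diag_self, hk, T.coeff_diag_self]

theorem isClosed_diagonal : IsClosed (T.diagonal : Set (T.RegularSpace →L[ℂ] T.RegularSpace)) := by
  have h : Isometry T.diag := AddMonoidHomClass.isometry_of_norm T.diag T.norm_diag
  have h2 : (T.diagonal : Set (T.RegularSpace →L[ℂ] T.RegularSpace)) = Set.range T.diag := by
    ext a
    simp [diagonal]
  rw [h2]
  exact h.isClosedEmbedding.isClosed_range

theorem mem_diagonal : a ∈ T.diagonal ↔ ∃ h, T.diag h = a := by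
  simp [diagonal]

theorem range_incl : Set.range T.incl = T.proj ⁻¹' unitSpace G := by
  ext σ
  constructor
  · rintro ⟨⟨z, x⟩, rfl⟩
    rw [Set.mem_preimage, T.proj_incl]
    exact x.2
  · exact T.exact σ

/-- The unit space is open (`G` is étale) and closed (`G` is Hausdorff), so extension by zero is
continuous. -/
theorem continuous_sectionOf_diag [T2Space G] (hG : IsEtale G) (h : C₀(unitSpace G, ℂ)) :
    Continuous (T.sectionOf (T.diag h)) := by
  have hemb : Topology.IsOpenEmbedding T.incl :=
    ⟨T.incl_isEmbedding, by
      rw [T.range_incl]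
      exact hG.isOpen_unitSpace.preimage T.continuous_proj⟩
  rw [continuous_iff_continuousAt]
  intro σ
  by_cases hσ : T.proj σ ∈ unitSpace G
  · obtain ⟨⟨z, x⟩, rfl⟩ := T.exact σ hσ
    rw [← hemb.continuousAt_iff]
    have h1 : T.sectionOf (T.diag h) ∘ T.incl = fun p => h p.2 * conj (p.1 : ℂ) := by
      funext p
      exact T.sectionOf_diag_incl h p.1 p.2
    rw [h1]
    have h2 : Continuous fun p : Circle × unitSpace G => h p.2 * conj (p.1 : ℂ) :=
      ((map_continuous h).comp continuous_snd).mul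
        (Complex.continuous_conj.comp (continuous_subtype_val.comp continuous_fst))
    exact h2.continuousAt
  · have hev : T.sectionOf (T.diag h) =ᶠ[nhds σ] fun _ => 0 := by
      filter_upwards [(isClosed_unitSpace.preimage T.continuous_proj).isOpen_compl.mem_nhds hσ]
        with τ hτ
      exact T.sectionOf_diag_of_notMem h τ hτ
    exact continuousAt_const.congr hev.symm

theorem locallyCompactSpace_unitSpace [T2Space G] [LocallyCompactSpace G] :
    LocallyCompactSpace (unitSpace G) :=
  isClosed_unitSpace.isClosedEmbedding_subtypeVal.locallyCompactSpace

theorem diag_mem_reducedAlgebra [T2Space G] [LocallyCompactSpace G] (hG : IsEtale G)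
    (h : C₀(unitSpace G, ℂ)) : T.diag h ∈ T.reducedAlgebra := by
  have := locallyCompactSpace_unitSpace (G := G)
  rw [reducedAlgebra, Metric.mem_closure_iff]
  intro ε hε
  obtain ⟨k, hk, K, hK, hkK⟩ := exists_zeroAtInfty_norm_sub_le h (half_pos hε)
  refine ⟨T.diag k, ⟨T.sectionOf (T.diag k), ?_,
    (T.isRegularRep_iff_isConv (T.isEquivariant_sectionOf _)).2 (T.isConv_diag k)⟩, ?_⟩
  · refine ⟨T.continuous_sectionOf_diag hG k, T.isEquivariant_sectionOf _, Subtype.val '' K,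
      hK.image continuous_subtype_val, fun σ hσ => ?_⟩
    by_cases hu : T.proj σ ∈ unitSpace G
    · refine ⟨⟨_, hu⟩, ?_, rfl⟩
      by_contra hn
      apply hσ
      obtain ⟨⟨z, x⟩, rfl⟩ := T.exact σ hu
      rw [T.sectionOf_diag_incl]
      rw [hkK x, zero_mul]
      convert hn
      exact (T.proj_incl z x).symm
    · exact absurd (T.sectionOf_diag_of_notMem k σ hu) hσ
  · rw [dist_eq_norm, ← map_sub, T.norm_diag]
    linarith

end

end Twist

/-! ### Inverses of bisections -/

namespace TopologicalGroupoid

variable {G : Type*} [TopologicalSpace G] [TopologicalGroupoid G]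

theorem injective_inv : Function.Injective fun γ : G => γ⁻¹ :=
  invHomeomorph.injective

theorem eq_of_mul_inv_eq_mul_inv {ρ γ δ : G} (h1 : s ρ = s γ) (h2 : s ρ = s δ)
    (h : ρ * γ⁻¹ = ρ * δ⁻¹) : γ = δ := by
  apply injective_inv
  change γ⁻¹ = δ⁻¹
  rw [← inv_mul_cancel_left_eq (h1.trans (r_inv γ).symm), h,
    inv_mul_cancel_left_eq (h2.trans (r_inv δ).symm)]

theorem IsBisection.inv {S : Set G} (hS : IsBisection S) :
    IsBisection ((fun γ : G => γ⁻¹) ⁻¹' S) := by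
  constructor
  · intro γ hγ δ hδ h
    exact injective_inv (hS.2 hγ hδ (by rw [s_inv, s_inv, h]))
  · intro γ hγ δ hδ h
    exact injective_inv (hS.1 hγ hδ (by rw [r_inv, r_inv, h]))

theorem sourceMap_image_inv (S : Set G) :
    (sourceMap '' ((fun γ : G => γ⁻¹) ⁻¹' S) : Set (unitSpace G)) = rangeMap '' S := by
  ext x
  constructor
  · rintro ⟨γ, hγ, rfl⟩
    exact ⟨γ⁻¹, hγ, Subtype.ext (r_inv γ)⟩
  · rintro ⟨γ, hγ, rfl⟩
    exact ⟨γ⁻¹, by rwa [Set.mem_preimage, inv_inv_eq], Subtype.ext (s_inv γ)⟩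

end TopologicalGroupoid

/-! ### Open supports and normalizers -/

namespace Twist

section

open TopologicalGroupoid

variable {G E : Type*} [TopologicalSpace G] [TopologicalGroupoid G]
  [TopologicalSpace E] [TopologicalGroupoid E] (T : Twist G E)
  {a b c : T.RegularSpace →L[ℂ] T.RegularSpace} {f g : E → ℂ}

theorem mem_openSupport_iff (a : T.RegularSpace →L[ℂ] T.RegularSpace) (σ : E) :
    T.proj σ ∈ T.openSupport a ↔ T.sectionOf a σ ≠ 0 := by
  constructor
  · rintro ⟨τ, hτ, h⟩ h0
    exact h ((T.isEquivariant_sectionOf a).eq_zero_of_proj_eq T hτ.symm h0)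
  · intro h
    exact ⟨σ, rfl, h⟩

theorem openSupport_diag_mul_subset (h : C₀(unitSpace G, ℂ)) :
    T.openSupport (T.diag h * a) ⊆ T.openSupport a := by
  rintro _ ⟨σ, rfl, hσ⟩
  rw [sectionOf_diag_mul] at hσ
  exact ⟨σ, rfl, right_ne_zero_of_mul hσ⟩

theorem sectionOf_star (ha : a ∈ T.reducedAlgebra) (σ : E) :
    T.sectionOf (star a) σ = conj (T.sectionOf a σ⁻¹) := by
  have h1 := (T.isConv_of_mem ha).star T
  rw [h1.sectionOf_eq]

theorem openSupport_star (ha : a ∈ T.reducedAlgebra) :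
    T.openSupport (star a) = (fun γ : G => γ⁻¹) ⁻¹' T.openSupport a := by
  ext γ
  obtain ⟨σ, rfl⟩ := T.surjective_proj γ
  rw [Set.mem_preimage, mem_openSupport_iff, ← T.proj_inv, mem_openSupport_iff,
    T.sectionOf_star ha, map_ne_zero]

/-- Being a squared norm, this entry vanishes only if `a` kills the point mass. -/
theorem coeff_star_mul_self (a : T.RegularSpace →L[ℂ] T.RegularSpace) (σ : E) :
    T.coeff (star a * a) σ σ = ⟪a (T.pointMass σ), a (T.pointMass σ)⟫_ℂ := by
  have h := T.value_apply_eq_inner (star a) (a (T.pointMass σ)) σ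
  rwa [star_star] at h

variable [T2Space G] [LocallyCompactSpace G]

theorem mul_mem_reducedAlgebra (hG : IsEtale G) (ha : a ∈ T.reducedAlgebra)
    (hb : b ∈ T.reducedAlgebra) :
    a * b ∈ T.reducedAlgebra :=
  (T.reducedStarAlgebra hG).mul_mem ha hb

theorem star_mem_reducedAlgebra (hG : IsEtale G) (ha : a ∈ T.reducedAlgebra) :
    star a ∈ T.reducedAlgebra :=
  (T.reducedStarAlgebra hG).star_mem' ha

/-- If the open supports of `a` and `c` are contained in a bisection, then `a⋆c` is in
`C₀(G⁽⁰⁾)`. -/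
theorem exists_diag_eq_star_mul (hG : IsEtale G) (ha : a ∈ T.reducedAlgebra)
    (hc : c ∈ T.reducedAlgebra) {S : Set G} (hS : IsBisection S) (haS : T.openSupport a ⊆ S) (hcS : T.openSupport c ⊆ S) :
    ∃ u : C₀(unitSpace G, ℂ), T.diag u = star a * c ∧
      (∀ ρ, T.proj ρ ∈ S →
        u (sourceMap (T.proj ρ)) = conj (T.sectionOf a ρ) * T.sectionOf c ρ) ∧
      ∀ x, x ∉ sourceMap '' T.openSupport a → u x = 0 := by
  have hca := T.isConv_of_mem ha
  have hcc := T.isConv_of_mem hc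
  have key : ∀ b, T.IsConv (T.sectionOf b) b → ∀ σ τ, T.coeff b σ τ ≠ 0 →
      s σ = s τ ∧ T.proj (σ * τ⁻¹) ∈ T.openSupport b := by
    intro b hb σ τ h
    have hst : s σ = s τ := by
      by_contra hst
      exact h (hb.2 _ _ hst)
    rw [hb.1 _ _ hst] at h
    exact ⟨hst, (T.mem_openSupport_iff b _).2 h⟩
  have hstar : ∀ σ ρ, T.coeff (star a) σ ρ ≠ 0 → T.coeff a ρ σ ≠ 0 := by
    intro σ ρ h h0
    rw [T.coeff_star, h0, map_zero] at h
    exact h rfl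
  obtain ⟨u, hu, hux⟩ := T.exists_diag_eq
    (T.mul_mem_reducedAlgebra hG (T.star_mem_reducedAlgebra hG ha) hc) (by
      intro σ τ hστ
      apply T.coeff_mul_eq_zero
      intro ρ
      by_contra hne
      obtain ⟨h1, h2⟩ := key a hca ρ σ (hstar _ _ (left_ne_zero_of_mul hne))
      obtain ⟨h3, h4⟩ := key c hcc ρ τ (right_ne_zero_of_mul hne)
      -- Both arrows lie in `S` and have range `r ρ`, so they agree, which forces `σ` and `τ` to lie
      -- over the same arrow.
      have h5 : T.proj (ρ * σ⁻¹) = T.proj (ρ * τ⁻¹) := hS.1 (haS h2) (hcS h4) (by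
        rw [← T.r_eq_r_iff, r_mul _ _ (h1.trans (r_inv _).symm),
          r_mul _ _ (h3.trans (r_inv _).symm)])
      rw [T.proj_mul_inv h1, T.proj_mul_inv h3] at h5
      apply hστ
      exact eq_of_mul_inv_eq_mul_inv ((T.s_eq_s_iff _ _).1 h1) ((T.s_eq_s_iff _ _).1 h3) h5)
  refine ⟨u, hu, ?_, ?_⟩
  · intro ρ hρ
    rw [hux, ← T.s_eq, T.coeff_mul_of_single _ _ _ _ ρ, T.coeff_star]
    · rfl
    · intro ρ' hρ'
      by_contra hne
      obtain ⟨h1, h2⟩ := key a hca ρ' _ (hstar _ _ (left_ne_zero_of_mul hne))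
      rw [s_s] at h1
      apply hρ'
      -- Injectivity of `s` on `S`: the column at the unit `s ρ` has no other nonzero entry.
      refine hS.2 ?_ hρ ((T.s_eq_s_iff _ _).1 h1)
      rw [← h1, mul_inv_s] at h2
      exact haS h2
  · intro x hx
    rw [hux]
    apply T.coeff_mul_eq_zero
    intro ρ
    by_contra hne
    obtain ⟨h1, h2⟩ := key a hca ρ _ (hstar _ _ (left_ne_zero_of_mul hne))
    rw [T.s_incl] at h1
    rw [← h1, mul_inv_s] at h2
    refine hx ⟨_, h2, Subtype.ext ?_⟩
    have h3 := congrArg T.proj h1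
    rwa [T.proj_s, T.proj_incl] at h3

/-! ### Elements whose open support is a bisection -/

/-- If the open support of `a` is a bisection, then `a⋆ba` is in `C₀(G⁽⁰⁾)` for all `b` in
`C₀(G⁽⁰⁾)`. -/
theorem exists_diag_eq_star_mul_diag_mul (hG : IsEtale G) (ha : a ∈ T.reducedAlgebra)
    (hS : IsBisection (T.openSupport a)) (h : C₀(unitSpace G, ℂ)) :
    ∃ u : C₀(unitSpace G, ℂ), T.diag u = star a * T.diag h * a ∧
      ∀ ρ, T.proj ρ ∈ T.openSupport a → u (sourceMap (T.proj ρ)) =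
        conj (T.sectionOf a ρ) * (h (rangeMap (T.proj ρ)) * T.sectionOf a ρ) := by
  obtain ⟨u, hu, h1, -⟩ := T.exists_diag_eq_star_mul hG ha
    (T.mul_mem_reducedAlgebra hG (T.diag_mem_reducedAlgebra hG h) ha) hS subset_rfl
    (T.openSupport_diag_mul_subset h)
  exact ⟨u, by rw [hu, mul_assoc], h1⟩

theorem mem_normalizerIn_of_isBisection (hG : IsEtale G) (ha : a ∈ T.reducedAlgebra)
    (hS : IsBisection (T.openSupport a)) :
    a ∈ normalizerIn T.reducedAlgebra (T.diagonal : Set (T.RegularSpace →L[ℂ] T.RegularSpace)) := by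
  refine ⟨ha, fun b hb => ?_, fun b hb => ?_⟩
  · obtain ⟨h, rfl⟩ := T.mem_diagonal.1 hb
    obtain ⟨u, hu, -⟩ := T.exists_diag_eq_star_mul_diag_mul hG (T.star_mem_reducedAlgebra hG ha)
      (by rw [T.openSupport_star ha]; exact hS.inv) h
    rw [star_star] at hu
    exact T.mem_diagonal.2 ⟨u, hu⟩
  · obtain ⟨h, rfl⟩ := T.mem_diagonal.1 hb
    obtain ⟨u, hu, -⟩ := T.exists_diag_eq_star_mul_diag_mul hG ha hS h
    exact T.mem_diagonal.2 ⟨u, hu⟩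

theorem exists_diag_eq_star_mul_self (hG : IsEtale G) (ha : a ∈ T.reducedAlgebra)
    (hS : IsBisection (T.openSupport a)) :
    ∃ p : C₀(unitSpace G, ℂ), T.diag p = star a * a ∧
      sourceMap '' T.openSupport a = {x | 0 < p x} ∧
      ∀ ρ, T.proj ρ ∈ T.openSupport a →
        p (sourceMap (T.proj ρ)) = conj (T.sectionOf a ρ) * T.sectionOf a ρ := by
  obtain ⟨p, hp, h1, h0⟩ := T.exists_diag_eq_star_mul hG ha ha hS subset_rfl subset_rfl
  refine ⟨p, hp, ?_, h1⟩
  ext x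
  constructor
  · rintro ⟨γ, hγ, rfl⟩
    obtain ⟨ρ, rfl⟩ := T.surjective_proj γ
    rw [Set.mem_ofPred_eq, h1 ρ hγ, Complex.conj_mul']
    have h2 : 0 < ‖T.sectionOf a ρ‖ := norm_pos_iff.2 ((T.mem_openSupport_iff a ρ).1 hγ)
    exact_mod_cast pow_pos h2 2
  · intro hx
    by_contra hn
    rw [Set.mem_ofPred_eq, h0 x hn] at hx
    exact hx.ne rfl

theorem isNormalizerHomeo_of_isBisectionHomeo (hG : IsEtale G) (ha : a ∈ T.reducedAlgebra)
    (hS : IsBisection (T.openSupport a))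
    {φ : OpenPartialHomeomorph (unitSpace G) (unitSpace G)}
    (hφ : IsBisectionHomeo (T.openSupport a) φ) : IsNormalizerHomeo T.diag a φ := by
  obtain ⟨p, hp, hps, hpx⟩ := T.exists_diag_eq_star_mul_self hG ha hS
  obtain ⟨q, hq, hqs, -⟩ := T.exists_diag_eq_star_mul_self hG (T.star_mem_reducedAlgebra hG ha)
    (by rw [T.openSupport_star ha]; exact hS.inv)
  rw [star_star] at hq
  rw [T.openSupport_star ha, sourceMap_image_inv] at hqs
  obtain ⟨h1, h2, h3⟩ := hφ
  refine ⟨p, q, hp, hq, h1.trans hps, h2.trans hqs, fun b => ?_⟩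
  obtain ⟨c, hc, hcx⟩ := T.exists_diag_eq_star_mul_diag_mul hG ha hS b
  refine ⟨c, hc, fun x hx => ?_⟩
  rw [h1] at hx
  obtain ⟨γ, hγ, rfl⟩ := hx
  obtain ⟨ρ, rfl⟩ := T.surjective_proj γ
  rw [hcx ρ hγ, h3 _ hγ, hpx ρ hγ]
  ring

/-- If `φ x ≠ ψ x`, a function `b` that is `1` at `ψ x` and `0` at `φ x` gives two values of `a⋆ba`
at `x`, since `a⋆a(x) > 0`. The relation `≈` ignores values off the source. -/
theorem isNormalizerHomeo_unique {φ ψ : OpenPartialHomeomorph (unitSpace G) (unitSpace G)}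
    (hφ : IsNormalizerHomeo T.diag a φ) (hψ : IsNormalizerHomeo T.diag a ψ) : ψ ≈ φ := by
  have := locallyCompactSpace_unitSpace (G := G)
  obtain ⟨p, q, hp, -, h1, -, h2⟩ := hφ
  obtain ⟨p', q', hp', -, h1', -, h2'⟩ := hψ
  obtain rfl : p = p' := T.diag_injective (hp.trans hp'.symm)
  refine ⟨h1'.trans h1.symm, fun x hx => ?_⟩
  have hx' : x ∈ φ.source := by rwa [h1, ← h1']
  by_contra hne
  obtain ⟨b, hb1, hb0⟩ := exists_zeroAtInfty_one_zero (compl_singleton_mem_nhds hne)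
  obtain ⟨c, hc, hcx⟩ := h2 b
  obtain ⟨c', hc', hcx'⟩ := h2' b
  obtain rfl : c = c' := T.diag_injective (hc.trans hc'.symm)
  have h3 := (hcx x hx').symm.trans (hcx' x hx)
  rw [hb1, hb0 _ (by simp), zero_mul, one_mul] at h3
  rw [h1, Set.mem_ofPred_eq, ← h3] at hx'
  exact hx'.ne rfl

/-! ### Normalizers of essentially principal groupoids -/

theorem star_mem_normalizerIn (hG : IsEtale G)
    (ha : a ∈ normalizerIn T.reducedAlgebra
      (T.diagonal : Set (T.RegularSpace →L[ℂ] T.RegularSpace))) :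
    star a ∈ normalizerIn T.reducedAlgebra
      (T.diagonal : Set (T.RegularSpace →L[ℂ] T.RegularSpace)) := by
  obtain ⟨h1, h2, h3⟩ := ha
  refine ⟨T.star_mem_reducedAlgebra hG h1, fun b hb => ?_, fun b hb => ?_⟩
  · rw [star_star]; exact h3 b hb
  · rw [star_star]; exact h2 b hb

/-- Disjoint functions `uᵢ` around two distinct ranges would give `dᵢ = a⋆(uᵢ⋆uᵢ)a` in `B`, both
nonzero at the common source, with `d₁ w d₂ = 0`. -/
theorem r_eq_r_of_mem_normalizerIn
    (ha : a ∈ normalizerIn T.reducedAlgebra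
      (T.diagonal : Set (T.RegularSpace →L[ℂ] T.RegularSpace)))
    {γ₁ γ₂ : G} (h₁ : γ₁ ∈ T.openSupport a) (h₂ : γ₂ ∈ T.openSupport a) (h : s γ₁ = s γ₂) :
    r γ₁ = r γ₂ := by
  have := locallyCompactSpace_unitSpace (G := G)
  obtain ⟨-, hl, hr⟩ := ha
  by_contra hne
  have hne' : (rangeMap γ₁ : unitSpace G) ≠ rangeMap γ₂ := fun hc => hne (congrArg Subtype.val hc)
  obtain ⟨V₁, V₂, hV₁, hV₂, hm₁, hm₂, hd⟩ := t2_separation hne'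
  obtain ⟨u₁, hu₁, hz₁⟩ := exists_zeroAtInfty_one_zero (hV₁.mem_nhds hm₁)
  obtain ⟨u₂, hu₂, hz₂⟩ := exists_zeroAtInfty_one_zero (hV₂.mem_nhds hm₂)
  -- With `star u * u` in the middle, `d` is `(ua)⋆(ua)`, whose value at the source of `γ` is a
  -- squared norm.
  have key : ∀ (γ : G) (u : C₀(unitSpace G, ℂ)), γ ∈ T.openSupport a → u (rangeMap γ) = 1 →
      ∃ d : C₀(unitSpace G, ℂ), T.diag d = star a * T.diag (star u * u) * a ∧
        d (sourceMap γ) ≠ 0 := by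
    intro γ u hγ hu
    obtain ⟨d, hd⟩ := T.mem_diagonal.1 (hr _ (T.mem_diagonal.2 ⟨star u * u, rfl⟩))
    refine ⟨d, hd, ?_⟩
    obtain ⟨ρ, rfl⟩ := T.surjective_proj γ
    have h1 : T.diag d = star (T.diag u * a) * (T.diag u * a) := by
      rw [hd, star_mul, map_mul, map_star]
      simp only [mul_assoc]
    have h2 : d (sourceMap (T.proj ρ)) = ⟪(T.diag u * a) (T.pointMass (s ρ)),
        (T.diag u * a) (T.pointMass (s ρ))⟫_ℂ := by
      rw [← T.coeff_diag_self, ← T.s_eq, h1, T.coeff_star_mul_self]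
    rw [h2, inner_self_ne_zero]
    intro h0
    have h3 : T.sectionOf (T.diag u * a) ρ = 0 := by
      rw [sectionOf, h0]
      exact map_zero (Line.eval T ρ rfl)
    rw [sectionOf_diag_mul, hu, one_mul] at h3
    exact (T.mem_openSupport_iff a ρ).1 hγ h3
  obtain ⟨d₁, hd₁, hn₁⟩ := key γ₁ u₁ h₁ hu₁
  obtain ⟨d₂, hd₂, hn₂⟩ := key γ₂ u₂ h₂ hu₂
  have hs : (sourceMap γ₁ : unitSpace G) = sourceMap γ₂ := Subtype.ext h
  rw [← hs] at hn₂
  -- `w` replaces the unit that `B` may lack: the hypothesis concerns `a w a⋆`, not `a a⋆`.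
  obtain ⟨w, hw, -⟩ := exists_zeroAtInfty_one_zero
    (Filter.univ_mem (f := nhds (sourceMap γ₁ : unitSpace G)))
  obtain ⟨e, he⟩ := T.mem_diagonal.1 (hl _ (T.mem_diagonal.2 ⟨w, rfl⟩))
  have h0 : star u₁ * u₁ * e * (star u₂ * u₂) = 0 := by
    ext x
    simp only [ZeroAtInftyContinuousMap.mul_apply, ZeroAtInftyContinuousMap.zero_apply]
    by_cases hx : x ∈ V₁
    · rw [hz₂ x (Set.disjoint_left.1 hd hx), mul_zero, mul_zero]
    · rw [hz₁ x hx, mul_zero, zero_mul, zero_mul]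
  have h1 : T.diag (d₁ * w * d₂) = 0 := by
    rw [map_mul, map_mul, hd₁, hd₂]
    calc star a * T.diag (star u₁ * u₁) * a * T.diag w * (star a * T.diag (star u₂ * u₂) * a)
        = star a * (T.diag (star u₁ * u₁) * (a * T.diag w * star a) *
            T.diag (star u₂ * u₂)) * a := by simp only [mul_assoc]
      _ = 0 := by rw [← he, ← map_mul, ← map_mul, h0, map_zero, mul_zero, zero_mul]
  have h2 : d₁ * w * d₂ = 0 := T.diag_injective (h1.trans (map_zero _).symm)
  have h3 := DFunLike.congr_fun h2 (sourceMap γ₁)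
  simp only [ZeroAtInftyContinuousMap.mul_apply, ZeroAtInftyContinuousMap.zero_apply, hw,
    mul_one] at h3
  exact mul_ne_zero hn₁ hn₂ h3

/-- Products `γ'δ'⁻¹` of arrows of the open support fill a neighborhood of `γδ⁻¹` inside the
isotropy, so `γδ⁻¹` is a unit. -/
theorem injOn_s_of_mem_normalizerIn (hG : IsEtale G) (hp : EssentiallyPrincipal G)
    (ha : a ∈ normalizerIn T.reducedAlgebra
      (T.diagonal : Set (T.RegularSpace →L[ℂ] T.RegularSpace))) :
    Set.InjOn (s : G → G) (T.openSupport a) := by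
  intro γ hγ δ hδ h
  have hS := T.isOpen_openSupport ha.1
  apply eq_of_mul_inv_mem_unitSpace h
  rw [← show _ = _ from hp, mem_interior_iff_mem_nhds]
  refine Filter.mem_of_superset (hG.mul_mem_nhds hS (hS.preimage continuous_inv') hγ
    (δ := δ⁻¹) (by rwa [Set.mem_preimage, inv_inv_eq]) (h.trans (r_inv δ).symm)) ?_
  rintro _ ⟨γ', hγ', δ', hδ', hc, rfl⟩
  change r _ = s _
  rw [r_mul _ _ hc, s_mul _ _ hc, ← r_inv δ']
  exact T.r_eq_r_of_mem_normalizerIn ha hγ' hδ' (by rw [s_inv, hc])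

theorem isBisection_of_mem_normalizerIn (hG : IsEtale G) (hp : EssentiallyPrincipal G)
    (ha : a ∈ normalizerIn T.reducedAlgebra
      (T.diagonal : Set (T.RegularSpace →L[ℂ] T.RegularSpace))) :
    IsBisection (T.openSupport a) := by
  refine ⟨fun γ hγ δ hδ h => ?_, T.injOn_s_of_mem_normalizerIn hG hp ha⟩
  have h1 := T.injOn_s_of_mem_normalizerIn hG hp (T.star_mem_normalizerIn hG ha)
  rw [T.openSupport_star ha.1] at h1
  apply injective_inv
  exact h1 (by rwa [Set.mem_preimage, inv_inv_eq]) (by rwa [Set.mem_preimage, inv_inv_eq])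
    (by rw [s_inv, s_inv, h])

/-! ### Regularity -/

theorem isRegularIn (hG : IsEtale G) : IsRegularIn T.reducedAlgebra T.diagonal := by
  refine ⟨?_, T.isClosed_diagonal, ?_⟩
  · intro b hb
    obtain ⟨h, rfl⟩ := T.mem_diagonal.1 hb
    exact T.diag_mem_reducedAlgebra hG h
  · apply Set.Subset.antisymm
    · rw [← T.coe_reducedStarAlgebra hG]
      refine NonUnitalStarSubalgebra.topologicalClosure_minimal _
        (NonUnitalStarAlgebra.adjoin_le fun n hn => hn.1)
        (NonUnitalStarSubalgebra.isClosed_topologicalClosure _)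
    · refine closure_mono ?_
      intro a ha
      -- Elements of the dense subalgebra are finite sums of operators supported on bisections, each
      -- of which is a normalizer.
      obtain ⟨n, F, c, hF, hc, rfl⟩ :=
        exists_sum_of_mem_compactSubmodule hG (show a ∈ T.compactSubmodule from ha)
      refine sum_mem fun i _ => NonUnitalStarAlgebra.subset_adjoin ℂ _ ?_
      refine T.mem_normalizerIn_of_isBisection hG (subset_closure
        (T.mem_compactSubmodule.2 ⟨_, (hF i).isCompactSection, hc i⟩)) ?_
      obtain ⟨-, -, U, K, -, hU, -, hKU, hFK⟩ := hF i
      refine hU.mono ?_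
      rintro _ ⟨σ, rfl, hσ⟩
      rw [(hc i).sectionOf_eq] at hσ
      exact hKU (hFK σ hσ)

end

end Twist

theorem mainTheorem5 {G E : Type*}
    [TopologicalSpace G] [TopologicalGroupoid G]
    [T2Space G] [LocallyCompactSpace G] [SecondCountableTopology G]
    [TopologicalSpace E] [TopologicalGroupoid E]
    (hG : TopologicalGroupoid.IsEtale G) (T : Twist G E) :
    (∀ a ∈ T.reducedAlgebra, TopologicalGroupoid.IsBisection (T.openSupport a) →
      a ∈ normalizerIn T.reducedAlgebra (T.diagonal : Set _) ∧
      ∃ φ : OpenPartialHomeomorph (TopologicalGroupoid.unitSpace G)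
          (TopologicalGroupoid.unitSpace G),
        TopologicalGroupoid.IsBisectionHomeo (T.openSupport a) φ ∧
        IsNormalizerHomeo T.diag a φ ∧
        ∀ ψ, IsNormalizerHomeo T.diag a ψ → ψ ≈ φ) ∧
    (TopologicalGroupoid.EssentiallyPrincipal G →
      normalizerIn T.reducedAlgebra (T.diagonal : Set _) =
        {a ∈ T.reducedAlgebra | TopologicalGroupoid.IsBisection (T.openSupport a)}) ∧
    IsRegularIn T.reducedAlgebra T.diagonal := by
  refine ⟨fun a ha hS => ⟨T.mem_normalizerIn_of_isBisection hG ha hS, ?_⟩, fun hp => ?_,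
    T.isRegularIn hG⟩
  · obtain ⟨φ, hφ⟩ := hG.exists_isBisectionHomeo (T.isOpen_openSupport ha) hS
    have hn := T.isNormalizerHomeo_of_isBisectionHomeo hG ha hS hφ
    exact ⟨φ, hφ, hn, fun ψ hψ => T.isNormalizerHomeo_unique hn hψ⟩
  · ext a
    exact ⟨fun ha => ⟨ha.1, T.isBisection_of_mem_normalizerIn hG hp ha⟩,
      fun ha => T.mem_normalizerIn_of_isBisection hG ha.1 ha.2⟩
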